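/- Let $q$ be a prime and let $W$ be a discrete memoryless channel with input alphabet $\mathcal X=\mathbb Z/q\mathbb Z$, finite output alphabet $\mathcal Y$ and transition probabilities $W(y\mid x)$. Its symmetric capacity is $$I(W)=\sum_{x\in\mathcal X}\sum_{y\in\mathcal Y}\tfrac1q W(y\mid x)\log_q\frac{W(y\mid x)}{\sum_{x'}\frac1q W(y\mid x')}$$ (terms with $W(y\mid x)=0$ are $0$), and its average Bhattacharyya distance is $$Z(W)=\frac1{q(q-1)}\sum_{x\ne x'}\sum_y\sqrt{W(y\mid x)W(y\mid x')}.$$ Put $x_1=u_1+u_2$, $x_2=u_2$ (addition modulo $q$), and define the $q$-ary input channels $$W^-(y_1,y_2\mid u_1)=\sum_{u_2\in\mathcal X}\tfrac1q W(y_1\mid u_1+u_2)W(y_2\mid u_2),\qquad W^+(y_1,y_2,u_1\mid u_2)=\tfrac1q W(y_1\mid u_1+u_2)W(y_2\mid u_2),$$ and, for $\mathbf s=(s_1,\dots,s_n)\in\{-,+\}^n$, $W^{\mathbf s}=(\cdots(W^{s_1})^{s_2}\cdots)^{s_n}$. (1) (Polarization.) For every $\delta>0$, $$\lim_{n\to\infty}\frac{\#\{\mathbf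 s\in\{-,+\}^n: I(W^{\mathbf s})\in(\delta,1-\delta)\}}{2^n}=0.$$ (2) (Rate.) Let $N=2^n$. The $n$-fold recursive application of the above transform maps $u=(u_{\mathbf s})_{\mathbf s\in\{-,+\}^n}\in\mathcal X^N$ bijectively to the input of $N$ independent uses of $W$, so that $u_{\mathbf s}$ is the input of $W^{\mathbf s}$. A polar code of rate $R$ for $W$ has an information set $A\subseteq\{-,+\}^n$ with $|A|=\max(\lfloor NR\rfloor,0)$ and $Z(W^{\mathbf s})\le Z(W^{\mathbf t})$ for all $\mathbf s\in A$, $\mathbf t\notin A$; a uniform message is placed in the coordinates $u_{\mathbf s}$, $\mathbf s\in A$, and the other coordinates are frozen to values known to the receiver. The successive cancellation decoder decides the coordinates in lexicographic order ($-$ before $+$): it knows the frozen ones, and decides $u_{\mathbf s}$, $\mathbf s\in A$, by maximum likelihood (ties broken by any fixed rule) from the channel output and its earlier decisions, treating the later coordinates as uniform. Then for all $R<I(W)$ and $\beta<1/2$ there is $n_0$ such that for all $n\ge n_0$, all such $A$ and all tie-breaking rules, the block error probability averaged over a uniform choice of the frozen values is at most $2^{-N^{\beta}}$; in particular there is a choice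 of the frozen values for which the block error probability satisfies $P_e\le 2^{-N^\beta}$. -/

import Mathlib

universe u

/-- A discrete memoryless channel with input alphabet `ℤ/qℤ` (with addition modulo `q`), given by a
finite output alphabet and its transition probabilities; `W.prob x y` is `W(y | x)`. -/
structure QChannel (q : ℕ) where
  /-- the output alphabet -/
  Out : Type u
  [fintypeOut : Fintype Out]
  /-- `prob x y` is the probability of the output `y` when `x` is sent -/
  prob : ZMod q → Out → ℝ
  prob_nonneg : ∀ x y, 0 ≤ prob x y
  sum_prob : ∀ x, ∑ y, prob x y = 1

attribute [instance] QChannel.fintypeOut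

namespace QChannel

noncomputable section

variable {q : ℕ} [NeZero q]

/-- The symmetric capacity `I(W)`, with logarithms to the base `q`. A term with `W(y | x) = 0`
is `0`, as usual; if `W(y | x) ≠ 0` then the denominator is positive. -/
def symCapacity (W : QChannel.{u} q) : ℝ :=
  ∑ x : ZMod q, ∑ y : W.Out,
    1 / (q : ℝ) * W.prob x y *
      Real.logb q (W.prob x y / ∑ x' : ZMod q, 1 / (q : ℝ) * W.prob x' y)

/-- The average Bhattacharyya distance `Z(W)`. -/
def avgBhattacharyya (W : QChannel.{u} q) : ℝ :=
  ∑ x : ZMod q, ∑ x' ∈ Finset.univ.filter (fun x' : ZMod q => x ≠ x'),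
    1 / ((q : ℝ) * ((q : ℝ) - 1)) * ∑ y : W.Out, Real.sqrt (W.prob x y * W.prob x' y)

/-- The channel `W⁻(y₁, y₂ | u₁) = ∑_{u₂} (1/q) W(y₁ | u₁ + u₂) W(y₂ | u₂)`. -/
def minus (W : QChannel.{u} q) : QChannel.{u} q where
  Out := W.Out × W.Out
  prob u₁ y := ∑ u₂ : ZMod q, 1 / (q : ℝ) * (W.prob (u₁ + u₂) y.1 * W.prob u₂ y.2)
  prob_nonneg u₁ y := Finset.sum_nonneg fun u₂ _ =>
    mul_nonneg (by positivity) (mul_nonneg (W.prob_nonneg _ _) (W.prob_nonneg _ _))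
  sum_prob u₁ := by
    rw [Finset.sum_comm]
    simp only [Fintype.sum_prod_type, ← Finset.mul_sum, W.sum_prob]
    simp [W.sum_prob, ZMod.card, NeZero.ne]

/-- The channel `W⁺(y₁, y₂, u₁ | u₂) = (1/q) W(y₁ | u₁ + u₂) W(y₂ | u₂)`. -/
def plus (W : QChannel.{u} q) : QChannel.{u} q where
  Out := W.Out × W.Out × ZMod q
  prob u₂ y := 1 / (q : ℝ) * (W.prob (y.2.2 + u₂) y.1 * W.prob u₂ y.2.1)
  prob_nonneg u₂ y :=
    mul_nonneg (by positivity) (mul_nonneg (W.prob_nonneg _ _) (W.prob_nonneg _ _))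
  sum_prob u₂ := by
    have h : ∀ (a : W.Out) (b : W.Out), ∑ c : ZMod q,
        1 / (q : ℝ) * (W.prob (c + u₂) a * W.prob u₂ b) =
        (1 / (q : ℝ) * ∑ c : ZMod q, W.prob (c + u₂) a) * W.prob u₂ b := by
      intro a b
      rw [Finset.mul_sum, Finset.sum_mul]
      exact Finset.sum_congr rfl fun c _ => by ring
    simp only [Fintype.sum_prod_type, h]
    simp only [← Finset.mul_sum, W.sum_prob, mul_one]
    rw [Finset.sum_comm]
    simp [W.sum_prob, ZMod.card, NeZero.ne]

/-- One polarization step; the sign `-` is `false` and the sign `+` is `true`. -/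
def step (W : QChannel.{u} q) (b : Bool) : QChannel.{u} q :=
  if b then W.plus else W.minus

/-- The channel `W^𝐬` for `𝐬 = (s₁, …, sₙ) ∈ {-, +}ⁿ`, i.e. `(⋯(W^{s₁})^{s₂}⋯)^{sₙ}`. -/
def level (W : QChannel.{u} q) {n : ℕ} (s : Fin n → Bool) : QChannel.{u} q :=
  (List.ofFn s).foldl step W

/-- The fraction of the `2ⁿ` channels at level `n` with symmetric capacity in `(δ, 1 - δ)`. -/
def unpolarizedFraction (W : QChannel.{u} q) (δ : ℝ) (n : ℕ) : ℝ :=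
  (Nat.card {s : Fin n → Bool // (W.level s).symCapacity ∈ Set.Ioo δ (1 - δ)} : ℝ) / 2 ^ n

/-- The polar transform of block length `N = 2ⁿ`, obtained by recursive application of
`x₁ = u₁ + u₂, x₂ = u₂`. The `N` coordinates of the input `u` are indexed by `{-, +}ⁿ`: the
coordinate `u_𝐬` is the input of the channel `W^𝐬`. For each first sign `b` the coordinates
`u_{b𝐬'}` are transformed to the inputs of the `N / 2` copies of `W^b`; the `t`-th copies of `W⁻`
and of `W⁺` come from the pair of channel uses `(-, t)`, `(+, t)` of `W`. -/
def polarTransform : (n : ℕ) → ((Fin n → Bool) → ZMod q) → ((Fin n → Bool) → ZMod q)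
  | 0, u => u
  | n + 1, u => fun t =>
      let v₁ := polarTransform n (fun s => u (Fin.cons false s)) (Fin.tail t)
      let v₂ := polarTransform n (fun s => u (Fin.cons true s)) (Fin.tail t)
      if t 0 then v₂ else v₁ + v₂

/-- The probability that `N = 2ⁿ` independent uses of `W` produce `y` when the input
of the polar transform is `u`. -/
def blockProb (W : QChannel.{u} q) {n : ℕ} (u : (Fin n → Bool) → ZMod q)
    (y : (Fin n → Bool) → W.Out) : ℝ :=
  ∏ t : Fin n → Bool, W.prob (polarTransform n u t) (y t)

open Classical in
/-- The probability `W_N^{(𝐬)}(y, v_{<𝐬} | x)` that `N` uses of `W` produce `y` and that the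
coordinates preceding `𝐬` (in the lexicographic order of `{-, +}ⁿ`, with `- < +`) have the values
`v`, when the coordinate `𝐬` is `x` and the other `N - 1` coordinates are independent and uniform. -/
def splitProb (W : QChannel.{u} q) {n : ℕ} (y : (Fin n → Bool) → W.Out)
    (s : Fin n → Bool) (v : (Fin n → Bool) → ZMod q) (x : ZMod q) : ℝ :=
  1 / (q : ℝ) ^ (2 ^ n - 1) *
    ∑ u ∈ Finset.univ.filter (fun u : (Fin n → Bool) → ZMod q =>
      (∀ r, toLex r < toLex s → u r = v r) ∧ u s = x), W.blockProb u y

/-- A rule that picks a maximizer of every function on the input alphabet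
(it decides how ties are broken). -/
def IsArgmaxRule (σ : (ZMod q → ℝ) → ZMod q) : Prop :=
  ∀ (g : ZMod q → ℝ) (x : ZMod q), g x ≤ g (σ g)

open Classical in
/-- The successive cancellation decoder with information set `A`, frozen symbols `f` and argmax
rule `σ`. It decides the coordinates one after the other, in lexicographic order: frozen coordinates
are known, and a coordinate `𝐬 ∈ A` is decided by maximum likelihood for the channel `W_N^{(𝐬)}`,
with the earlier decisions in the place of the true values of the earlier coordinates. -/
def scDecode (W : QChannel.{u} q) (σ : (ZMod q → ℝ) → ZMod q) {n : ℕ}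
    (A : Finset (Fin n → Bool)) (f : {s // s ∉ A} → ZMod q) (y : (Fin n → Bool) → W.Out)
    (s : Fin n → Bool) : ZMod q :=
  if h : s ∈ A then
    σ (W.splitProb y s (fun r => if toLex r < toLex s then scDecode W σ A f y r else 0))
  else f ⟨s, h⟩
termination_by (wellFounded_lt (α := Lex (Fin n → Bool))).wrap (toLex s)
decreasing_by assumption

/-- The input of the polar transform made up of a message `m` on the information set `A` and
frozen symbols `f` outside `A`. -/
def codeInput {n : ℕ} (A : Finset (Fin n → Bool)) (m : {s // s ∈ A} → ZMod q)
    (f : {s // s ∉ A} → ZMod q) : (Fin n → Bool) → ZMod q :=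
  fun s => if h : s ∈ A then m ⟨s, h⟩ else f ⟨s, h⟩

open Classical in
/-- The block error probability, under successive cancellation decoding, of the code of
block length `2ⁿ` with information set `A` and frozen symbols `f`, for a uniform message. -/
def blockError (W : QChannel.{u} q) (σ : (ZMod q → ℝ) → ZMod q) {n : ℕ}
    (A : Finset (Fin n → Bool)) (f : {s // s ∉ A} → ZMod q) : ℝ :=
  1 / (q : ℝ) ^ A.card * ∑ m : {s // s ∈ A} → ZMod q,
    ∑ y ∈ Finset.univ.filter (fun y : (Fin n → Bool) → W.Out =>
      W.scDecode σ A f y ≠ codeInput A m f), W.blockProb (codeInput A m f) y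

/-- The block error probability averaged over all choices of the frozen symbols. -/
def avgBlockError (W : QChannel.{u} q) (σ : (ZMod q → ℝ) → ZMod q) {n : ℕ}
    (A : Finset (Fin n → Bool)) : ℝ :=
  1 / (q : ℝ) ^ (2 ^ n - A.card) * ∑ f : {s // s ∉ A} → ZMod q, W.blockError σ A f

/-- `A` is the information set of a polar code for `W`: it consists of indices `𝐬` with the smallest
values of `Z(W^𝐬)`. -/
def IsPolarInfoSet (W : QChannel.{u} q) {n : ℕ} (A : Finset (Fin n → Bool)) : Prop :=
  ∀ s ∈ A, ∀ t ∉ A, (W.level s).avgBhattacharyya ≤ (W.level t).avgBhattacharyya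

end

end QChannel

/-!
# Polarization and rate of polarization of `q`-ary polar codes, `q` prime

*Polarization.* Up to normalization, `1 - I(W)` is the mean entropy of the posterior law of a
uniform input (`symCapacity_eq`, `equivocation_eq_of_posterior`). The chain rule for the pair
`(X₁ - X₂, X₂)` gives `I(W⁻) + I(W⁺) = 2 I(W)`, so the capacity is a bounded martingale along the
binary tree of channels and its increments tend to `0` in mean square. The posteriors of `W⁻` are
the laws of differences of two independent elements of `ℤ/qℤ`. By Jensen's inequality the entropy
of such a difference exceeds that of the minuend, strictly unless the minuend is uniform or the
subtrahend is deterministic; here `q` has to be prime (`entropy_lt_entropy_diffConv`). By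
compactness of the simplex the gain is bounded below, and this bounds the increment `I(W) - I(W⁻)`
below uniformly over all channels with capacity in `(δ, 1 - δ)` (`exists_capacity_gap`). Such
channels must therefore become rare (`tendsto_unpolarizedFraction`), and since the mean capacity is
conserved, a fraction `I(W)` of the channels becomes nearly perfect.

*Rate.* The Bhattacharyya sum `S(W) = q (q - 1) Z(W)` satisfies `S(W⁺) ≤ S(W)²` and
`S(W⁻) ≤ q³ S(W)`, and it is small when the capacity is near `1`. The theorem
`BranchingProcess.eventually_avgProb_rate` turns smallness into `S ≤ exp (-2 ^ (β n))`: a small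
power `Φ = S ^ η` satisfies `Φ⁺ ≤ Φ²` and `Φ⁻ ≤ exp κ * Φ` with `κ` as small as desired; a
supermartingale argument makes `Φ` exponentially small within a few steps (`avgProb_gt_le`), and
from then on its exponent doubles at every `+`, which is about half of the time
(`avgProb_exp_lt_le`).

*Decoding.* By induction on `n`, along the recursion of the polar transform, a decoder that knows
the true earlier symbols sees exactly the channel `W^𝐬` (`genie_expectation`). The first wrong
decision of the successive cancellation decoder is also an error of this genie-aided decoder, so
the mean block error probability is at most the sum of the maximum likelihood error probabilities
of the `W^𝐬`, `𝐬 ∈ A`, and these are bounded by Bhattacharyya sums (`avgBlockError_le`).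
-/

/-! ### Averages over the binary tree of a two-valued step -/

namespace BranchingProcess

variable {α : Type*} (st : α → Bool → α)

/-- The mean of `φ` over the two children of a state. -/
noncomputable def stepAvg (φ : α → ℝ) : α → ℝ :=
  fun a => (φ (st a false) + φ (st a true)) / 2

/-- The mean of `φ` over the `2 ^ n` descendants of a state after `n` steps. -/
noncomputable def avg (n : ℕ) : (α → ℝ) → α → ℝ := (stepAvg st)^[n]

/-- The fraction of the `2 ^ n` descendants after `n` steps that lie in `A`. -/
noncomputable def avgProb (n : ℕ) (A : Set α) : α → ℝ := avg st n (A.indicator 1)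

variable {st}

@[simp] lemma avg_zero (φ : α → ℝ) : avg st 0 φ = φ := rfl

lemma avg_succ (n : ℕ) (φ : α → ℝ) (a : α) :
    avg st (n + 1) φ a = (avg st n φ (st a false) + avg st n φ (st a true)) / 2 := by
  rw [avg, Function.iterate_succ_apply']
  rfl

lemma avg_succ_stepAvg (n : ℕ) (φ : α → ℝ) : avg st (n + 1) φ = avg st n (stepAvg st φ) :=
  Function.iterate_succ_apply _ _ _

lemma avg_add_steps (m n : ℕ) (φ : α → ℝ) : avg st (m + n) φ = avg st m (avg st n φ) :=
  Function.iterate_add_apply _ _ _ _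

lemma avg_mono {φ ψ : α → ℝ} (h : ∀ a, φ a ≤ ψ a) (n : ℕ) (a : α) :
    avg st n φ a ≤ avg st n ψ a := by
  induction n generalizing a with
  | zero => exact h a
  | succ n ih =>
    rw [avg_succ, avg_succ]
    linarith [ih (st a false), ih (st a true)]

lemma avg_add (φ ψ : α → ℝ) (n : ℕ) (a : α) :
    avg st n (fun a => φ a + ψ a) a = avg st n φ a + avg st n ψ a := by
  induction n generalizing a with
  | zero => rfl
  | succ n ih => rw [avg_succ, avg_succ, avg_succ, ih, ih]; ring

lemma avg_const_mul (c : ℝ) (φ : α → ℝ) (n : ℕ) (a : α) :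
    avg st n (fun a => c * φ a) a = c * avg st n φ a := by
  induction n generalizing a with
  | zero => rfl
  | succ n ih => rw [avg_succ, avg_succ, ih, ih]; ring

lemma avg_const (c : ℝ) (n : ℕ) (a : α) : avg st n (fun _ => c) a = c := by
  induction n generalizing a with
  | zero => rfl
  | succ n ih => rw [avg_succ, ih, ih]; ring

lemma avg_of_stepAvg_eq {φ : α → ℝ} (h : stepAvg st φ = φ) (n : ℕ) : avg st n φ = φ := by
  induction n with
  | zero => rfl
  | succ n ih => rw [avg_succ_stepAvg, h, ih]

lemma avg_eq_sum (n : ℕ) (φ : α → ℝ) (a : α) :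
    avg st n φ a = (∑ s : Fin n → Bool, φ ((List.ofFn s).foldl st a)) / 2 ^ n := by
  induction n generalizing a with
  | zero => simp
  | succ n ih =>
    rw [avg_succ, ih, ih, ← (Fin.consEquiv fun _ => Bool).sum_comp, Fintype.sum_prod_type]
    have e : ∀ b s, (List.ofFn (Fin.consEquiv (fun _ => Bool) (b, s))).foldl st a =
        (List.ofFn s).foldl st (st a b) := fun b (s : Fin n → Bool) => by
      change (List.ofFn (Fin.cons b s : Fin (n + 1) → Bool)).foldl st a = _
      rw [List.ofFn_cons, List.foldl_cons]
    simp only [Fintype.sum_bool, e, pow_succ]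
    field_simp
    ring

lemma avgProb_succ (n : ℕ) (A : Set α) (a : α) :
    avgProb st (n + 1) A a = (avgProb st n A (st a false) + avgProb st n A (st a true)) / 2 :=
  avg_succ _ _ _

lemma indicator_one_nonneg (A : Set α) (a : α) : (0 : ℝ) ≤ A.indicator 1 a :=
  Set.indicator_nonneg (fun _ _ => zero_le_one) a

lemma indicator_one_le_one (A : Set α) (a : α) : A.indicator 1 a ≤ (1 : ℝ) :=
  Set.indicator_le_self' (fun _ _ => zero_le_one) a

lemma avgProb_nonneg (n : ℕ) (A : Set α) (a : α) : 0 ≤ avgProb st n A a := by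
  have := avg_mono (st := st) (indicator_one_nonneg A) n a
  rwa [avg_const] at this

lemma avgProb_le_one (n : ℕ) (A : Set α) (a : α) : avgProb st n A a ≤ 1 := by
  have := avg_mono (st := st) (indicator_one_le_one A) n a
  rwa [avg_const] at this

lemma avgProb_mono {A B : Set α} (h : A ⊆ B) (n : ℕ) (a : α) :
    avgProb st n A a ≤ avgProb st n B a :=
  avg_mono (Set.indicator_le_indicator_of_subset h fun _ => zero_le_one) n a

lemma avgProb_eq_card (n : ℕ) (A : Set α) (a : α) :
    avgProb st n A a =
      (Nat.card {s : Fin n → Bool // (List.ofFn s).foldl st a ∈ A} : ℝ) / 2 ^ n := by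
  classical
  rw [avgProb, avg_eq_sum, Nat.card_eq_fintype_card, Fintype.card_subtype]
  simp [Set.indicator_apply, Finset.sum_boole]

/-- The union bound at an intermediate time. -/
lemma avgProb_add_le {m n : ℕ} {A B : Set α} {c : ℝ} (hc : 0 ≤ c)
    (h : ∀ b ∉ B, avgProb st n A b ≤ c) (a : α) :
    avgProb st (m + n) A a ≤ avgProb st m B a + c := by
  rw [avgProb, avg_add_steps]
  have : ∀ b, avg st n (A.indicator 1) b ≤ B.indicator 1 b + c := by
    intro b
    by_cases hb : b ∈ B
    · have := avgProb_le_one (st := st) n A b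
      rw [avgProb] at this
      simp only [Set.indicator_of_mem hb, Pi.one_apply]
      linarith
    · rw [Set.indicator_of_notMem hb, zero_add]
      exact h b hb
  refine (avg_mono this m a).trans ?_
  rw [avg_add, avg_const, avgProb]

/-! ### Rate of polarization -/

/-- Exponential decay. A quantity `Φ` that is squared by one step and multiplied by at most `5/4` by
the other decays geometrically, except with a probability that is small when `Φ` starts small:
as long as `Φ ≤ 1/2`, its mean contracts by `7/8`, and when `Φ > 1/2` the bound exceeds `1`. -/
lemma avgProb_gt_le {Φ : α → ℝ} (h0 : ∀ a, 0 ≤ Φ a)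
    (hm : ∀ a, Φ (st a false) ≤ 5 / 4 * Φ a) (hp : ∀ a, Φ (st a true) ≤ Φ a ^ 2)
    {t : ℝ} (ht : 0 < t) (m : ℕ) (a : α) :
    avgProb st m {b | t < Φ b} a ≤ 2 * Φ a + (7 / 8) ^ m * Φ a / t := by
  induction m generalizing a with
  | zero =>
    rw [avgProb, avg_zero]
    by_cases h : t < Φ a
    · rw [Set.indicator_of_mem (by exact h)]
      have : 1 ≤ Φ a / t := by rw [le_div_iff₀ ht]; linarith
      simp only [Pi.one_apply, pow_zero, one_mul]
      linarith [h0 a]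
    · rw [Set.indicator_of_notMem (by exact h)]
      have := h0 a
      positivity
  | succ m ih =>
    have hnn : (0 : ℝ) ≤ (7 / 8) ^ m / t := by positivity
    by_cases h : 1 / 2 < Φ a
    · refine (avgProb_le_one _ _ _).trans ?_
      have : (0 : ℝ) ≤ (7 / 8) ^ (m + 1) * Φ a / t := by have := h0 a; positivity
      linarith
    · rw [avgProb_succ]
      have h1 : Φ (st a false) + Φ (st a true) ≤ 2 * (7 / 8 * Φ a) := by
        nlinarith [hm a, hp a, h0 a]
      calc _ ≤ (2 + (7 / 8) ^ m / t) * ((Φ (st a false) + Φ (st a true)) / 2) := by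
              have e : ∀ x : ℝ, 2 * x + (7 / 8) ^ m * x / t = (2 + (7 / 8) ^ m / t) * x := by
                intro x; ring
              have i1 := ih (st a false)
              have i2 := ih (st a true)
              rw [e] at i1 i2
              linarith
        _ ≤ (2 + (7 / 8) ^ m / t) * (7 / 8 * Φ a) := by
              gcongr
              linarith
        _ ≤ _ := by
              have := h0 a
              rw [pow_succ]
              have e : (7 / 8 : ℝ) ^ m * (7 / 8) * Φ a / t = (7 / 8) ^ m / t * (7 / 8 * Φ a) := by
                ring
              rw [e, add_mul]
              linarith

/-- A Chernoff bound for the exponent of a quantity `Φ` that is squared by one step and multiplied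
by at most `exp k` by the other: after `m` steps the exponent has doubled `b` times, up to the loss
`k * m`, except with a probability that is at most the exponential-moment bound, with parameter `t`,
for a binomial variable to be below `b`. -/
lemma avgProb_exp_lt_le {Φ : α → ℝ} (h0 : ∀ a, 0 ≤ Φ a) {k : ℝ} (hk : 0 ≤ k)
    (hm : ∀ a, Φ (st a false) ≤ Real.exp k * Φ a) (hp : ∀ a, Φ (st a true) ≤ Φ a ^ 2)
    {t : ℝ} (ht : 0 ≤ t) (m : ℕ) (b x : ℝ) (a : α) (hx : k * m ≤ x) (ha : Φ a ≤ Real.exp (-x)) :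
    avgProb st m {c | Real.exp (-((2 : ℝ) ^ b * (x - k * m))) < Φ c} a ≤
      Real.exp (t * b) * ((1 + Real.exp (-t)) / 2) ^ m := by
  induction m generalizing a b x with
  | zero =>
    simp only [Nat.cast_zero, mul_zero, sub_zero, pow_zero, mul_one] at hx ⊢
    rcases le_or_gt b 0 with hb | hb
    · rw [avgProb, avg_zero, Set.indicator_of_notMem]
      · positivity
      · simp only [Set.mem_ofPred_eq, not_lt]
        refine ha.trans (Real.exp_le_exp.2 (neg_le_neg ?_))
        exact mul_le_of_le_one_left hx (Real.rpow_le_one_of_one_le_of_nonpos one_le_two hb)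
    · exact (avgProb_le_one _ _ _).trans (Real.one_le_exp (by positivity))
  | succ m ih =>
    rw [avgProb_succ]
    push_cast at hx ⊢
    have hkm : 0 ≤ k * m := by positivity
    have e1 : avgProb st m {c | Real.exp (-((2 : ℝ) ^ b * (x - k * (m + 1)))) < Φ c} (st a false)
        ≤ Real.exp (t * b) * ((1 + Real.exp (-t)) / 2) ^ m := by
      have := ih b (x - k) (st a false) (by linarith) ((hm a).trans ?_)
      · convert this using 6
        ring
      · rw [show -(x - k) = k + -x by ring, Real.exp_add]
        gcongr
    have e2 : avgProb st m {c | Real.exp (-((2 : ℝ) ^ b * (x - k * (m + 1)))) < Φ c} (st a true)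
        ≤ Real.exp (t * (b - 1)) * ((1 + Real.exp (-t)) / 2) ^ m := by
      refine le_trans (avgProb_mono ?_ _ _)
        (ih (b - 1) (2 * x) (st a true) (by linarith) ((hp a).trans ?_))
      · intro c hc
        refine lt_of_le_of_lt (Real.exp_le_exp.2 (neg_le_neg ?_)) hc
        rw [Real.rpow_sub_one two_ne_zero, div_mul_eq_mul_div, le_div_iff₀ two_pos, mul_assoc]
        gcongr
        linarith
      · calc Φ a ^ 2 ≤ Real.exp (-x) ^ 2 := by have := h0 a; gcongr
          _ = Real.exp (-(2 * x)) := by rw [← Real.exp_nat_mul]; congr 1; push_cast; ring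
    have e3 : Real.exp (t * (b - 1)) = Real.exp (t * b) * Real.exp (-t) := by
      rw [← Real.exp_add]; congr 1; ring
    rw [e3] at e2
    rw [pow_succ]
    linarith

lemma one_add_exp_neg_div_two_le (t : ℝ) :
    (1 + Real.exp (-t)) / 2 ≤ Real.exp (-(t / 2) + t ^ 2 / 8) := by
  have h := Real.cosh_le_exp_half_sq (t / 2)
  have e : (1 + Real.exp (-t)) / 2 = Real.exp (-(t / 2)) * Real.cosh (t / 2) := by
    have h1 : Real.exp (-(t / 2)) * Real.exp (t / 2) = 1 := by rw [← Real.exp_add]; simp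
    have h2 : Real.exp (-(t / 2)) * Real.exp (-(t / 2)) = Real.exp (-t) := by
      rw [← Real.exp_add]; congr 1; ring
    rw [Real.cosh_eq, ← h1, ← h2]; ring
  rw [e, Real.exp_add]
  gcongr
  refine h.trans (le_of_eq ?_)
  congr 1; ring

open Filter in
/-- If `S` is squared by one step and multiplied by at most `K` by the other, then, up to vanishing
probability, once `S` is small it becomes smaller than `exp (-2 ^ (β n))`, for every `β < 1/2`. -/
theorem eventually_avgProb_rate {S : α → ℝ} (h0 : ∀ a, 0 ≤ S a) {K : ℝ} (hK : 1 ≤ K)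
    (hm : ∀ a, S (st a false) ≤ K * S a) (hp : ∀ a, S (st a true) ≤ S a ^ 2)
    {p : ℝ} {a : α}
    (hS : ∀ ζ : ℝ, 0 < ζ → ∀ ε : ℝ, 0 < ε →
      ∀ᶠ m in atTop, avgProb st m {b | ζ < S b} a ≤ p + ε)
    {β : ℝ} (hβ0 : 0 < β) (hβ : β < 1 / 2) {ε : ℝ} (hε : 0 < ε) :
    ∀ᶠ n : ℕ in atTop,
      avgProb st n {b | Real.exp (-(2 : ℝ) ^ (β * n)) < S b} a ≤ p + ε := by
  obtain ⟨g, hg⟩ : ∃ g : ℝ, g = (1 / 2 - β) / 4 := ⟨_, rfl⟩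
  have hg0 : 0 < g := by linarith
  have hg1 : g < 1 / 8 := by linarith
  obtain ⟨c, hc⟩ : ∃ c : ℝ, c = Real.log (16 / 15) := ⟨_, rfl⟩
  have hc0 : 0 < c := hc ▸ Real.log_pos (by norm_num)
  -- `κ` is so small that the loss `κ * n` is half of the exponent gained in `g * n` steps
  obtain ⟨κ, hκ⟩ : ∃ κ : ℝ, κ = min (Real.log (5 / 4)) (c * g / 2) := ⟨_, rfl⟩
  have hκ0 : 0 < κ := hκ ▸ lt_min (Real.log_pos (by norm_num)) (by positivity)
  have hκ1 : Real.exp κ ≤ 5 / 4 := by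
    rw [← Real.le_log_iff_exp_le (by norm_num), hκ]; exact min_le_left _ _
  have hκ2 : κ ≤ c * g / 2 := hκ ▸ min_le_right _ _
  have hlK : 0 ≤ Real.log K := Real.log_nonneg hK
  obtain ⟨η, hη⟩ : ∃ η : ℝ, η = min 1 (κ / (Real.log K + 1)) := ⟨_, rfl⟩
  have hη0 : 0 < η := hη ▸ lt_min one_pos (by positivity)
  have hη1 : η ≤ 1 := hη ▸ min_le_left _ _
  have hKη : K ^ η ≤ Real.exp κ := by
    rw [Real.rpow_def_of_pos (by linarith), Real.exp_le_exp]
    have h1 : η ≤ κ / (Real.log K + 1) := hη ▸ min_le_right _ _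
    rw [le_div_iff₀ (by positivity)] at h1
    linarith
  -- the power `Φ = S ^ η` obeys the same recursion with `K` close to `1`
  obtain ⟨Φ, hΦ⟩ : ∃ Φ : α → ℝ, Φ = fun b => S b ^ η := ⟨_, rfl⟩
  have hΦ0 : ∀ b, 0 ≤ Φ b := fun b => hΦ ▸ Real.rpow_nonneg (h0 b) _
  have hΦm : ∀ b, Φ (st b false) ≤ Real.exp κ * Φ b := by
    intro b
    simp only [hΦ]
    calc S (st b false) ^ η ≤ (K * S b) ^ η := Real.rpow_le_rpow (h0 _) (hm b) hη0.le
      _ = K ^ η * S b ^ η := Real.mul_rpow (by linarith) (h0 b)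
      _ ≤ _ := by have := Real.rpow_nonneg (h0 b) η; gcongr
  have hΦp : ∀ b, Φ (st b true) ≤ Φ b ^ 2 := by
    intro b
    simp only [hΦ]
    calc S (st b true) ^ η ≤ (S b ^ 2) ^ η := Real.rpow_le_rpow (h0 _) (hp b) hη0.le
      _ = _ := by
        rw [← Real.rpow_natCast, ← Real.rpow_natCast, ← Real.rpow_mul (h0 b),
          ← Real.rpow_mul (h0 b), mul_comm]
  have hΦm' : ∀ b, Φ (st b false) ≤ 5 / 4 * Φ b := fun b =>
    (hΦm b).trans (mul_le_mul_of_nonneg_right hκ1 (hΦ0 b))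
  obtain ⟨ζ, hζ⟩ : ∃ ζ : ℝ, ζ = min 1 (ε / 8) := ⟨_, rfl⟩
  have hζ0 : 0 < ζ := hζ ▸ lt_min one_pos (by positivity)
  have hζ1 : ζ ≤ 1 := hζ ▸ min_le_left _ _
  have hζ2 : ζ ≤ ε / 8 := hζ ▸ min_le_right _ _
  have hj : Tendsto (fun n : ℕ => ⌊g * n⌋₊) atTop atTop :=
    tendsto_nat_floor_atTop.comp (tendsto_natCast_atTop_atTop.const_mul_atTop hg0)
  have ev1 := hj.eventually (hS (ζ ^ (1 / η)) (by positivity) (ε / 4) (by positivity))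
  have ev2 : ∀ᶠ n : ℕ in atTop, (14 / 15 : ℝ) ^ ⌊g * n⌋₊ ≤ ε / 4 :=
    hj.eventually ((tendsto_pow_atTop_nhds_zero_of_lt_one (by norm_num)
      (by norm_num)).eventually_le_const (by positivity : (0 : ℝ) < ε / 4))
  have ev3 : ∀ᶠ n : ℕ in atTop, Real.exp (-(16 * g ^ 2)) ^ n ≤ ε / 4 :=
    (tendsto_pow_atTop_nhds_zero_of_lt_one (Real.exp_pos _).le
      (Real.exp_lt_one_iff.2 (by have := pow_pos hg0 2; linarith))).eventually_le_const
        (by positivity)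
  have ev4 : ∀ᶠ n : ℕ in atTop, c + 1 ≤ c * g / 2 * n :=
    (tendsto_natCast_atTop_atTop.const_mul_atTop (by positivity)).eventually_ge_atTop _
  filter_upwards [ev1, ev2, ev3, ev4] with n h1 h2 h3 h4
  obtain ⟨j, hjn⟩ : ∃ j : ℕ, j = ⌊g * n⌋₊ := ⟨_, rfl⟩
  rw [← hjn] at h1 h2
  have hgn : 0 ≤ g * n := by positivity
  have j1 : (j : ℝ) ≤ g * n := hjn ▸ Nat.floor_le hgn
  have j2 : g * n < j + 1 := hjn ▸ Nat.lt_floor_add_one _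
  obtain ⟨m, hmn⟩ : ∃ m : ℕ, n = j + (j + m) := by
    have : j + j ≤ n := by
      have : (j + j : ℝ) ≤ n := by
        have : (0 : ℝ) ≤ n := by positivity
        nlinarith
      exact_mod_cast this
    exact ⟨n - (j + j), by omega⟩
  have hmr : (n : ℝ) = j + (j + m) := by exact_mod_cast hmn
  have hx : 1 ≤ c * j - κ * m := by
    have hn0 : (0 : ℝ) ≤ n := by positivity
    have hmle : (m : ℝ) ≤ n := by have : (0 : ℝ) ≤ j := by positivity
                                  linarith
    have a1 : κ * m ≤ c * g / 2 * n := mul_le_mul hκ2 hmle (by positivity) (by positivity)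
    have a2 : c * (g * n) ≤ c * (j + 1) := by gcongr
    linarith
  have hgood : ∀ b, ¬ (15 / 16 : ℝ) ^ j < Φ b →
      avgProb st m {b | Real.exp (-(2 : ℝ) ^ (β * n)) < S b} b ≤ ε / 4 := by
    intro b hb
    have hb' : Φ b ≤ Real.exp (-(c * j)) := by
      refine (not_lt.1 hb).trans (le_of_eq ?_)
      rw [mul_comm, ← mul_neg, Real.exp_nat_mul, hc, ← Real.log_inv, Real.exp_log (by norm_num)]
      norm_num
    have key := avgProb_exp_lt_le (st := st) hΦ0 hκ0.le hΦm hΦp (t := 8 * g) (by positivity) m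
      (β * n) (c * j) b (by linarith) hb'
    refine (avgProb_mono ?_ _ _).trans (key.trans ?_)
    · intro d hd
      simp only [Set.mem_ofPred_eq] at hd ⊢
      have hX : (0 : ℝ) < 2 ^ (β * n) := by positivity
      calc Real.exp (-((2 : ℝ) ^ (β * n) * (c * j - κ * m)))
          ≤ Real.exp (-(2 : ℝ) ^ (β * n) * η) := by
            refine Real.exp_le_exp.2 ?_
            rw [neg_mul]
            refine neg_le_neg ?_
            gcongr
            linarith
        _ = Real.exp (-(2 : ℝ) ^ (β * n)) ^ η := by rw [Real.exp_mul]
        _ < Φ d := by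
            rw [hΦ]
            exact Real.rpow_lt_rpow (Real.exp_pos _).le hd hη0
    · refine le_trans ?_ h3
      calc _ ≤ Real.exp (8 * g * (β * n)) * Real.exp (-((8 * g) / 2) + (8 * g) ^ 2 / 8) ^ m := by
            gcongr
            exact one_add_exp_neg_div_two_le _
        _ = Real.exp (8 * g * (β * n) + m * (-((8 * g) / 2) + (8 * g) ^ 2 / 8)) := by
            rw [Real.exp_add (8 * g * (β * n)), Real.exp_nat_mul]
        _ ≤ Real.exp (n * -(16 * g ^ 2)) := by
            refine Real.exp_le_exp.2 ?_
            have hb2 : β = 1 / 2 - 4 * g := by linarith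
            have hn0 : (0 : ℝ) ≤ n := by positivity
            have hj0 : (0 : ℝ) ≤ j := by positivity
            have hmle : (m : ℝ) ≤ n := by linarith
            have hm2 : (n : ℝ) - 2 * (g * n) ≤ m := by linarith
            rw [hb2]
            have : g * ((n : ℝ) - 2 * (g * n)) ≤ g * m := by gcongr
            have : g ^ 2 * (m : ℝ) ≤ g ^ 2 * n := by gcongr
            nlinarith
        _ = _ := by rw [Real.exp_nat_mul]
  have hmid : ∀ b, ¬ ζ ^ (1 / η) < S b →
      avgProb st (j + m) {b | Real.exp (-(2 : ℝ) ^ (β * n)) < S b} b ≤ 3 * ε / 4 := by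
    intro b hb
    have hb' : Φ b ≤ ζ := by
      rw [hΦ]
      calc S b ^ η ≤ (ζ ^ (1 / η)) ^ η := Real.rpow_le_rpow (h0 b) (not_lt.1 hb) hη0.le
        _ = ζ := by rw [← Real.rpow_mul hζ0.le, one_div_mul_cancel hη0.ne', Real.rpow_one]
    refine (avgProb_add_le (B := {b | (15 / 16 : ℝ) ^ j < Φ b}) (by positivity) hgood b).trans ?_
    have key := avgProb_gt_le (st := st) hΦ0 hΦm' hΦp (t := (15 / 16) ^ j) (by positivity) j b
    have e : (7 / 8 : ℝ) ^ j * Φ b / (15 / 16) ^ j = (14 / 15) ^ j * Φ b := by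
      rw [mul_div_right_comm, ← div_pow]; norm_num
    rw [e] at key
    have : (14 / 15 : ℝ) ^ j * Φ b ≤ (14 / 15) ^ j * 1 := by gcongr; linarith
    linarith
  have := avgProb_add_le (st := st) (m := j) (B := {b | ζ ^ (1 / η) < S b}) (by positivity) hmid a
  rw [← hmn] at this
  linarith

end BranchingProcess

namespace QChannel

/-! ### Entropy of differences on `ℤ/qℤ` -/

section Entropy

variable {q : ℕ} [NeZero q]

/-- The entropy of a vector with nonnegative entries, in nats. -/
noncomputable def entropy (p : ZMod q → ℝ) : ℝ := ∑ x, Real.negMulLog (p x)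

/-- The law of `X₁ - X₂` for independent `X₁ ∼ p` and `X₂ ∼ r`. -/
noncomputable def diffConv (p r : ZMod q → ℝ) : ZMod q → ℝ := fun z => ∑ x, p (z + x) * r x

lemma continuous_entropy : Continuous (entropy (q := q)) := by
  unfold entropy
  fun_prop

lemma continuous_diffConv :
    Continuous (fun pr : (ZMod q → ℝ) × (ZMod q → ℝ) => diffConv pr.1 pr.2) := by
  unfold diffConv
  fun_prop

lemma sum_add_right (f : ZMod q → ℝ) (x : ZMod q) : ∑ z, f (z + x) = ∑ z, f z :=
  Equiv.sum_comp (Equiv.addRight x) f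

lemma sum_add_left (f : ZMod q → ℝ) (x : ZMod q) : ∑ z, f (x + z) = ∑ z, f z :=
  Equiv.sum_comp (Equiv.addLeft x) f

lemma sum_diffConv (p r : ZMod q → ℝ) : ∑ z, diffConv p r z = (∑ x, p x) * ∑ x, r x := by
  unfold diffConv
  rw [Finset.sum_comm, Finset.mul_sum]
  refine Finset.sum_congr rfl fun x _ => ?_
  rw [← Finset.sum_mul, sum_add_right]

lemma diffConv_mem_stdSimplex {p r : ZMod q → ℝ} (hp : p ∈ stdSimplex ℝ (ZMod q))
    (hr : r ∈ stdSimplex ℝ (ZMod q)) : diffConv p r ∈ stdSimplex ℝ (ZMod q) :=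
  ⟨fun _ => Finset.sum_nonneg fun _ _ => mul_nonneg (hp.1 _) (hr.1 _), by
    rw [sum_diffConv, hp.2, hr.2, one_mul]⟩

lemma negMulLog_nonneg_of_mem {p : ZMod q → ℝ} (hp : p ∈ stdSimplex ℝ (ZMod q)) (x : ZMod q) :
    0 ≤ Real.negMulLog (p x) :=
  Real.negMulLog_nonneg (hp.1 x)
    (hp.2 ▸ Finset.single_le_sum (fun y _ => hp.1 y) (Finset.mem_univ x))

lemma entropy_nonneg {p : ZMod q → ℝ} (hp : p ∈ stdSimplex ℝ (ZMod q)) : 0 ≤ entropy p :=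
  Finset.sum_nonneg fun x _ => negMulLog_nonneg_of_mem hp x

lemma sum_mul_negMulLog_shift {p r : ZMod q → ℝ} (hr : ∑ x, r x = 1) :
    ∑ z, ∑ x, r x * Real.negMulLog (p (z + x)) = entropy p := by
  rw [Finset.sum_comm]
  have : ∀ x, ∑ z, r x * Real.negMulLog (p (z + x)) = r x * entropy p := fun x => by
    rw [← Finset.mul_sum, sum_add_right (fun z => Real.negMulLog (p z)), entropy]
  simp only [this, ← Finset.sum_mul, hr, one_mul]

lemma sum_mul_negMulLog_le {p r : ZMod q → ℝ} (hp : p ∈ stdSimplex ℝ (ZMod q))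
    (hr : r ∈ stdSimplex ℝ (ZMod q)) (z : ZMod q) :
    ∑ x, r x * Real.negMulLog (p (z + x)) ≤ Real.negMulLog (diffConv p r z) := by
  have := Real.concaveOn_negMulLog.le_map_sum (t := Finset.univ) (w := r)
    (p := fun x => p (z + x)) (fun x _ => hr.1 x) hr.2 (fun x _ => hp.1 _)
  simpa only [smul_eq_mul, mul_comm (r _) (p _), diffConv] using this

lemma entropy_le_entropy_diffConv {p r : ZMod q → ℝ} (hp : p ∈ stdSimplex ℝ (ZMod q))
    (hr : r ∈ stdSimplex ℝ (ZMod q)) : entropy p ≤ entropy (diffConv p r) := by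
  rw [← sum_mul_negMulLog_shift (p := p) hr.2]
  exact Finset.sum_le_sum fun z _ => sum_mul_negMulLog_le hp hr z

lemma entropy_uniform : entropy (fun _ : ZMod q => (q : ℝ)⁻¹) = Real.log q := by
  have hq : (q : ℝ) ≠ 0 := NeZero.ne _
  simp [entropy, Real.negMulLog, ZMod.card, hq]

lemma uniform_mem_stdSimplex : (fun _ : ZMod q => (q : ℝ)⁻¹) ∈ stdSimplex ℝ (ZMod q) := by
  have hq : (q : ℝ) ≠ 0 := NeZero.ne _
  exact ⟨fun _ => by positivity, by simp [ZMod.card, hq]⟩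

lemma entropy_le_log {p : ZMod q → ℝ} (hp : p ∈ stdSimplex ℝ (ZMod q)) :
    entropy p ≤ Real.log q := by
  have h := entropy_le_entropy_diffConv hp uniform_mem_stdSimplex
  have e : diffConv p (fun _ => (q : ℝ)⁻¹) = fun _ => (q : ℝ)⁻¹ := by
    funext z
    have : ∑ x, p (z + x) = 1 := by rw [sum_add_left, hp.2]
    rw [diffConv, ← Finset.sum_mul, this, one_mul]
  rwa [e, entropy_uniform] at h

/-- Since `-log p ≥ 1 - p`, an entropy in nats bounds the collision of two different letters. -/
lemma mul_le_entropy {p : ZMod q → ℝ} (hp : p ∈ stdSimplex ℝ (ZMod q)) {x x' : ZMod q}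
    (hx : x ≠ x') : p x * p x' ≤ entropy p := by
  have h1 : p x + p x' ≤ 1 := by
    rw [← hp.2, ← Finset.sum_pair hx]
    exact Finset.sum_le_sum_of_subset_of_nonneg (Finset.subset_univ _) fun y _ _ => hp.1 y
  have h2 : p x * p x' ≤ Real.negMulLog (p x) := by
    rcases (hp.1 x).eq_or_lt with h | h
    · simp [← h]
    · have := Real.log_le_sub_one_of_pos h
      rw [Real.negMulLog]
      nlinarith
  exact h2.trans (Finset.single_le_sum (f := fun y => Real.negMulLog (p y))
    (fun y _ => negMulLog_nonneg_of_mem hp y) (Finset.mem_univ x))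

end Entropy

section PrimeEntropy

variable {q : ℕ} [Fact q.Prime]

/-- The place where primality of `q`, and not only `q > 1`, is needed: a law on `ℤ/qℤ` that
is invariant under a nonzero translation is uniform. -/
lemma eq_uniform_of_add_eq {p : ZMod q → ℝ} (hp : p ∈ stdSimplex ℝ (ZMod q)) {d : ZMod q}
    (hd : d ≠ 0) (h : ∀ z, p (z + d) = p z) : p = fun _ => (q : ℝ)⁻¹ := by
  have h1 : ∀ (n : ℕ), p (n * d) = p 0 := by
    intro n
    induction n with
    | zero => simp
    | succ n ih => rw [Nat.cast_succ, add_mul, one_mul, h, ih]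
  have h2 : ∀ z, p z = p 0 := by
    intro z
    have := h1 (z * d⁻¹).val
    rwa [ZMod.natCast_zmod_val, inv_mul_cancel_right₀ hd] at this
  have h3 := hp.2
  have hq : (q : ℝ) ≠ 0 := NeZero.ne _
  simp only [h2, Finset.sum_const, Finset.card_univ, ZMod.card, nsmul_eq_mul] at h3
  funext z
  rw [h2 z]
  exact eq_inv_of_mul_eq_one_right h3

/-- Equality in the Jensen inequality behind `entropy_le_entropy_diffConv` forces one of the laws
to be deterministic or the other one to be uniform. -/
lemma entropy_lt_entropy_diffConv {p r : ZMod q → ℝ} (hp : p ∈ stdSimplex ℝ (ZMod q))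
    (hr : r ∈ stdSimplex ℝ (ZMod q)) (hp' : entropy p < Real.log q) (hr' : 0 < entropy r) :
    entropy p < entropy (diffConv p r) := by
  by_contra hcon
  have heq := (entropy_le_entropy_diffConv hp hr).antisymm (not_lt.1 hcon)
  rw [← sum_mul_negMulLog_shift (p := p) hr.2, entropy,
    Finset.sum_eq_sum_iff_of_le fun z _ => sum_mul_negMulLog_le hp hr z] at heq
  have key : ∀ z a b, r a ≠ 0 → r b ≠ 0 → p (z + a) = p (z + b) := by
    intro z a b ha hb
    have h1 : Real.negMulLog (∑ x, r x • p (z + x)) =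
        ∑ x, r x • Real.negMulLog (p (z + x)) := by
      simp only [smul_eq_mul]
      rw [heq z (Finset.mem_univ z), diffConv]
      simp only [mul_comm (r _) (p _)]
    rw [Real.strictConcaveOn_negMulLog.map_sum_eq_iff' (fun x _ => hr.1 x) hr.2
      (fun x _ => hp.1 _)] at h1
    rw [h1 a (Finset.mem_univ a) ha, h1 b (Finset.mem_univ b) hb]
  obtain ⟨a, ha⟩ : ∃ a, r a ≠ 0 := by
    by_contra hall
    push Not at hall
    have := hr.2
    simp [hall] at this
  by_cases hex : ∃ b, b ≠ a ∧ r b ≠ 0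
  · obtain ⟨b, hba, hb⟩ := hex
    have := eq_uniform_of_add_eq hp (sub_ne_zero.2 hba) fun z => by
      have := key (z - a) b a hb ha
      rw [sub_add_cancel] at this
      rw [← this]; congr 1; ring
    rw [this, entropy_uniform] at hp'
    exact hp'.false
  · push Not at hex
    have h1 : r a = 1 := by
      rw [← hr.2]
      exact (Finset.sum_eq_single a (fun b _ hb => hex b hb) (by simp)).symm
    have : entropy r = 0 := by
      refine Finset.sum_eq_zero fun b _ => ?_
      by_cases hb : b = a
      · rw [hb, h1, Real.negMulLog_one]
      · rw [hex b hb, Real.negMulLog_zero]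
    rw [this] at hr'
    exact hr'.false

/-- By compactness of the simplex, the entropy gain of a difference is bounded below uniformly. -/
lemma exists_entropy_gap {δ : ℝ} (hδ : 0 < δ) :
    ∃ ε : ℝ, 0 < ε ∧ ∀ p ∈ stdSimplex ℝ (ZMod q), ∀ r ∈ stdSimplex ℝ (ZMod q),
      entropy p ≤ Real.log q - δ → δ ≤ entropy r → ε ≤ entropy (diffConv p r) - entropy p := by
  obtain ⟨K, hK⟩ : ∃ K : Set ((ZMod q → ℝ) × (ZMod q → ℝ)),
      K = (stdSimplex ℝ (ZMod q) ×ˢ stdSimplex ℝ (ZMod q)) ∩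
        ({pr | entropy pr.1 ≤ Real.log q - δ} ∩ {pr | δ ≤ entropy pr.2}) := ⟨_, rfl⟩
  have hc : IsCompact K := by
    rw [hK]
    refine ((isCompact_stdSimplex ℝ _).prod (isCompact_stdSimplex ℝ _)).inter_right
      (IsClosed.inter ?_ ?_)
    · exact isClosed_le (continuous_entropy.comp continuous_fst) continuous_const
    · exact isClosed_le continuous_const (continuous_entropy.comp continuous_snd)
  have hmem : ∀ p ∈ stdSimplex ℝ (ZMod q), ∀ r ∈ stdSimplex ℝ (ZMod q),
      entropy p ≤ Real.log q - δ → δ ≤ entropy r → (p, r) ∈ K := by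
    intro p hp r hr h1 h2
    rw [hK]
    exact ⟨⟨hp, hr⟩, h1, h2⟩
  rcases K.eq_empty_or_nonempty with h | h
  · refine ⟨1, one_pos, fun p hp r hr h1 h2 => ?_⟩
    have := hmem p hp r hr h1 h2
    rw [h] at this
    exact this.elim
  · obtain ⟨x, hx, hmin⟩ := hc.exists_isMinOn h
      ((continuous_entropy.comp continuous_diffConv).sub
        (continuous_entropy.comp continuous_fst)).continuousOn
    refine ⟨_, ?_, fun p hp r hr h1 h2 => hmin (hmem p hp r hr h1 h2)⟩
    rw [hK] at hx
    obtain ⟨⟨h1, h2⟩, h3, h4⟩ := hx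
    exact sub_pos.2 (entropy_lt_entropy_diffConv h1 h2
      (lt_of_le_of_lt h3 (by linarith)) (lt_of_lt_of_le hδ h4))

end PrimeEntropy

end QChannel

namespace QChannel

/-! ### Symmetric capacity: conservation and strict loss -/

section Capacity

variable {q : ℕ} [NeZero q]

/-- The sum over the outputs `y` of a functional of the likelihoods `x ↦ W(y | x)`. -/
noncomputable def outputSum (W : QChannel.{u} q) (F : (ZMod q → ℝ) → ℝ) : ℝ :=
  ∑ y, F (fun x => W.prob x y)

/-- The entropy of an unnormalized law `f`, that is, the total mass of `f` times the entropy of its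
normalization. -/
noncomputable def massEntropy (f : ZMod q → ℝ) : ℝ := entropy f - Real.negMulLog (∑ x, f x)

/-- `q` times the conditional entropy, in nats, of a uniform input given the output. -/
noncomputable def equivocation (W : QChannel.{u} q) : ℝ := W.outputSum massEntropy

lemma massEntropy_const_mul (c : ℝ) (f : ZMod q → ℝ) :
    massEntropy (fun x => c * f x) = c * massEntropy f := by
  simp only [massEntropy, entropy, Real.negMulLog_mul, Finset.sum_add_distrib, ← Finset.sum_mul,
    ← Finset.mul_sum]
  ring

lemma massEntropy_of_mem {p : ZMod q → ℝ} (hp : p ∈ stdSimplex ℝ (ZMod q)) :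
    massEntropy p = entropy p := by
  rw [massEntropy, hp.2, Real.negMulLog_one, sub_zero]

/-- The chain rule for the entropy of `(X₁ - X₂, X₂)`, for `(X₁, X₂)` distributed as `f ⊗ g`. -/
lemma massEntropy_chain_rule (f g : ZMod q → ℝ) :
    massEntropy (diffConv f g) + ∑ c, massEntropy (fun u => f (c + u) * g u) =
      (∑ x, g x) * massEntropy f + (∑ x, f x) * massEntropy g := by
  have h1 : ∑ c, massEntropy (fun u => f (c + u) * g u) =
      (∑ c, ∑ u, Real.negMulLog (f (c + u) * g u)) - entropy (diffConv f g) := by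
    simp only [massEntropy, entropy, diffConv, Finset.sum_sub_distrib]
  have h2 : ∑ c, ∑ u, Real.negMulLog (f (c + u) * g u) =
      (∑ x, g x) * entropy f + (∑ x, f x) * entropy g := by
    rw [Finset.sum_comm]
    have : ∀ u, ∑ c, Real.negMulLog (f (c + u) * g u) =
        g u * entropy f + (∑ x, f x) * Real.negMulLog (g u) := by
      intro u
      rw [sum_add_right (fun c => Real.negMulLog (f c * g u)) u]
      simp only [Real.negMulLog_mul, Finset.sum_add_distrib, ← Finset.mul_sum, ← Finset.sum_mul,
        entropy]
    simp only [this, Finset.sum_add_distrib, ← Finset.mul_sum, ← Finset.sum_mul, entropy]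
  rw [h1, h2, massEntropy, sum_diffConv, Real.negMulLog_mul, massEntropy, massEntropy]
  ring

lemma sum_sum_prob (W : QChannel.{u} q) : ∑ y, ∑ x, W.prob x y = q := by
  rw [Finset.sum_comm]
  simp [W.sum_prob, ZMod.card]

lemma equivocation_minus (W : QChannel.{u} q) :
    W.minus.equivocation = 1 / q * ∑ y₁, ∑ y₂,
      massEntropy (diffConv (fun x => W.prob x y₁) (fun x => W.prob x y₂)) := by
  rw [equivocation, outputSum, Finset.mul_sum]
  refine (Fintype.sum_prod_type _).trans (Finset.sum_congr rfl fun y₁ _ => ?_)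
  rw [Finset.mul_sum]
  refine Finset.sum_congr rfl fun y₂ _ => ?_
  rw [← massEntropy_const_mul]
  simp only [minus, diffConv, Finset.mul_sum]

lemma equivocation_plus (W : QChannel.{u} q) :
    W.plus.equivocation = 1 / q * ∑ y₁, ∑ y₂, ∑ c,
      massEntropy (fun u => W.prob (c + u) y₁ * W.prob u y₂) := by
  rw [equivocation, outputSum, Finset.mul_sum]
  refine (Fintype.sum_prod_type _).trans (Finset.sum_congr rfl fun y₁ _ => ?_)
  rw [Finset.mul_sum]
  refine (Fintype.sum_prod_type _).trans (Finset.sum_congr rfl fun y₂ _ => ?_)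
  rw [Finset.mul_sum]
  refine Finset.sum_congr rfl fun c _ => ?_
  rw [← massEntropy_const_mul]
  rfl

lemma equivocation_minus_add_plus (W : QChannel.{u} q) :
    W.minus.equivocation + W.plus.equivocation = 2 * W.equivocation := by
  have hq : (q : ℝ) ≠ 0 := NeZero.ne _
  rw [equivocation_minus, equivocation_plus, ← mul_add, ← Finset.sum_add_distrib]
  simp only [← Finset.sum_add_distrib]
  simp only [massEntropy_chain_rule (fun x => W.prob x _) (fun x => W.prob x _),
    Finset.sum_add_distrib, ← Finset.mul_sum, ← Finset.sum_mul, W.sum_sum_prob]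
  rw [equivocation, outputSum]
  field_simp
  ring

/-- Each output determines a posterior law of a uniform input. -/
lemma exists_posterior (W : QChannel.{u} q) : ∃ p : W.Out → ZMod q → ℝ,
    (∀ y, p y ∈ stdSimplex ℝ (ZMod q)) ∧ ∀ y x, W.prob x y = (∑ x, W.prob x y) * p y x := by
  have : ∀ y, ∃ p ∈ stdSimplex ℝ (ZMod q), ∀ x, W.prob x y = (∑ x, W.prob x y) * p x := by
    intro y
    by_cases h : ∑ x, W.prob x y = 0
    · -- an output of probability zero: any law will do
      refine ⟨_, uniform_mem_stdSimplex, fun x => ?_⟩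
      rw [h, zero_mul]
      exact (Finset.sum_eq_zero_iff_of_nonneg fun x _ => W.prob_nonneg x y).1 h x
        (Finset.mem_univ x)
    · refine ⟨fun x => W.prob x y / ∑ x, W.prob x y, ⟨fun x => div_nonneg (W.prob_nonneg _ _)
        (Finset.sum_nonneg fun x _ => W.prob_nonneg x y), ?_⟩, fun x => ?_⟩
      · rw [← Finset.sum_div, div_self h]
      · rw [mul_div_cancel₀ _ h]
  choose p hp hp' using this
  exact ⟨p, hp, hp'⟩

variable {W : QChannel.{u} q} {p : W.Out → ZMod q → ℝ}

lemma equivocation_eq_of_posterior (hp : ∀ y, p y ∈ stdSimplex ℝ (ZMod q))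
    (hW : ∀ y x, W.prob x y = (∑ x, W.prob x y) * p y x) :
    W.equivocation = ∑ y, (∑ x, W.prob x y) * entropy (p y) := by
  refine Finset.sum_congr rfl fun y _ => ?_
  exact (congrArg massEntropy (funext (hW y))).trans
    (by rw [massEntropy_const_mul, massEntropy_of_mem (hp y)])

lemma equivocation_minus_eq_of_posterior (hp : ∀ y, p y ∈ stdSimplex ℝ (ZMod q))
    (hW : ∀ y x, W.prob x y = (∑ x, W.prob x y) * p y x) :
    W.minus.equivocation = 1 / q * ∑ y₁, ∑ y₂,
      (∑ x, W.prob x y₁) * (∑ x, W.prob x y₂) * entropy (diffConv (p y₁) (p y₂)) := by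
  rw [equivocation_minus]
  congr 1
  refine Finset.sum_congr rfl fun y₁ _ => Finset.sum_congr rfl fun y₂ _ => ?_
  have : diffConv (fun x => W.prob x y₁) (fun x => W.prob x y₂) = fun z =>
      (∑ x, W.prob x y₁) * (∑ x, W.prob x y₂) * diffConv (p y₁) (p y₂) z := by
    funext z
    rw [diffConv, diffConv, Finset.mul_sum]
    refine Finset.sum_congr rfl fun x _ => ?_
    rw [hW y₁ (z + x), hW y₂ x]
    ring
  rw [this, massEntropy_const_mul, massEntropy_of_mem (diffConv_mem_stdSimplex (hp _) (hp _))]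

lemma sum_prob_input_nonneg (W : QChannel.{u} q) (y : W.Out) : 0 ≤ ∑ x, W.prob x y :=
  Finset.sum_nonneg fun x _ => W.prob_nonneg x y

lemma equivocation_nonneg (W : QChannel.{u} q) : 0 ≤ W.equivocation := by
  obtain ⟨p, hp, hW⟩ := W.exists_posterior
  rw [equivocation_eq_of_posterior hp hW]
  exact Finset.sum_nonneg fun y _ => mul_nonneg (W.sum_prob_input_nonneg y) (entropy_nonneg (hp y))

lemma equivocation_le (W : QChannel.{u} q) : W.equivocation ≤ q * Real.log q := by
  obtain ⟨p, hp, hW⟩ := W.exists_posterior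
  rw [equivocation_eq_of_posterior hp hW, ← W.sum_sum_prob, Finset.sum_mul, W.sum_sum_prob]
  exact Finset.sum_le_sum fun y _ =>
    mul_le_mul_of_nonneg_left (entropy_le_log (hp y)) (W.sum_prob_input_nonneg y)

end Capacity

section PrimeCapacity

variable {q : ℕ} [Fact q.Prime]

lemma log_alphabet_pos : 0 < Real.log q :=
  Real.log_pos (by exact_mod_cast (Fact.out : q.Prime).one_lt)

lemma alphabet_pos : (0 : ℝ) < q := by exact_mod_cast (Fact.out : q.Prime).pos

lemma symCapacity_eq (W : QChannel.{u} q) :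
    W.symCapacity = 1 - W.equivocation / (q * Real.log q) := by
  have hq : (0 : ℝ) < q := alphabet_pos
  have hL : 0 < Real.log q := log_alphabet_pos
  have key : ∀ y x, 1 / (q : ℝ) * W.prob x y *
      Real.logb q (W.prob x y / ∑ x' : ZMod q, 1 / (q : ℝ) * W.prob x' y) =
      (W.prob x y * Real.log q - Real.negMulLog (W.prob x y)
        - W.prob x y * Real.log (∑ x, W.prob x y)) / (q * Real.log q) := by
    intro y x
    rcases (W.prob_nonneg x y).eq_or_lt with h | h
    · simp [← h]
    · have hs : 0 < ∑ x, W.prob x y := lt_of_lt_of_le h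
        (Finset.single_le_sum (fun x _ => W.prob_nonneg x y) (Finset.mem_univ x))
      rw [← Finset.mul_sum, Real.logb, Real.log_div h.ne' (by positivity),
        Real.log_mul (by positivity) hs.ne', one_div, Real.log_inv, Real.negMulLog]
      field_simp
      ring
  rw [symCapacity, Finset.sum_comm]
  simp only [key, ← Finset.sum_div, Finset.sum_sub_distrib, ← Finset.sum_mul]
  rw [W.sum_sum_prob, sub_sub, sub_div, div_self (by positivity), equivocation, outputSum]
  congr 2
  rw [← Finset.sum_add_distrib]
  refine Finset.sum_congr rfl fun y _ => ?_
  rw [massEntropy, entropy, Real.negMulLog]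
  ring

lemma symCapacity_le_one (W : QChannel.{u} q) : W.symCapacity ≤ 1 := by
  rw [symCapacity_eq, sub_le_self_iff]
  exact div_nonneg W.equivocation_nonneg (mul_pos alphabet_pos log_alphabet_pos).le

lemma symCapacity_nonneg (W : QChannel.{u} q) : 0 ≤ W.symCapacity := by
  rw [symCapacity_eq, sub_nonneg, div_le_one (mul_pos alphabet_pos log_alphabet_pos)]
  exact W.equivocation_le

lemma symCapacity_minus_add_plus (W : QChannel.{u} q) :
    W.minus.symCapacity + W.plus.symCapacity = 2 * W.symCapacity := by
  have h := W.equivocation_minus_add_plus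
  rw [symCapacity_eq, symCapacity_eq, symCapacity_eq, mul_sub, mul_div_assoc', ← h]
  ring

/-- A reverse Markov inequality: if the weighted sum of a function bounded by `L` exceeds `δ` times
the total weight by `c`, then the points where it is at least `δ` have weight at least `c / L`. -/
lemma le_mul_sum_of_le_sum_mul {ι : Type*} [Fintype ι] {s h : ι → ℝ} {L δ c : ℝ}
    (hs : ∀ i, 0 ≤ s i) (hδ : 0 ≤ δ) (hL : ∀ i, h i ≤ L)
    (hsum : δ * ∑ i, s i + c ≤ ∑ i, s i * h i) [DecidablePred fun i => δ ≤ h i] :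
    c ≤ L * ∑ i, if δ ≤ h i then s i else 0 := by
  have : ∑ i, s i * h i ≤ δ * ∑ i, s i + L * ∑ i, if δ ≤ h i then s i else 0 := by
    rw [Finset.mul_sum, Finset.mul_sum, ← Finset.sum_add_distrib]
    refine Finset.sum_le_sum fun i _ => ?_
    have := hs i
    split_ifs with hi
    · nlinarith [hL i, mul_nonneg hδ this]
    · nlinarith [not_le.1 hi]
  linarith

/-- A channel that is neither nearly perfect nor nearly useless loses capacity under `W ↦ W⁻`, by an
amount that does not depend on the output alphabet: with probability bounded below, the posterior
of the first use is not nearly uniform and that of the second one is not nearly deterministic. -/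
theorem exists_capacity_gap {δ : ℝ} (hδ : 0 < δ) :
    ∃ ε : ℝ, 0 < ε ∧ ∀ W : QChannel.{u} q, W.symCapacity ∈ Set.Ioo δ (1 - δ) →
      ε ≤ W.symCapacity - W.minus.symCapacity := by
  classical
  have hq : (0 : ℝ) < q := alphabet_pos
  obtain ⟨L, hLdef⟩ : ∃ L, L = Real.log q := ⟨_, rfl⟩
  have hL : 0 < L := hLdef ▸ log_alphabet_pos
  obtain ⟨d, hd⟩ : ∃ d, d = δ * L / 2 := ⟨_, rfl⟩
  have hd0 : 0 < d := by rw [hd]; positivity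
  obtain ⟨ε, hε, hgap⟩ := exists_entropy_gap (q := q) hd0
  refine ⟨1 / q * (ε * ((q * δ / 2) * (q * δ / 2))) / (q * L), by positivity, fun W hI => ?_⟩
  obtain ⟨p, hp, hW⟩ := W.exists_posterior
  rw [symCapacity_eq, ← hLdef] at hI
  rw [symCapacity_eq, symCapacity_eq, ← hLdef]
  have hE1 : δ * (q * L) < W.equivocation := by
    have := hI.2
    rw [← lt_div_iff₀ (by positivity)]; linarith
  have hE2 : W.equivocation < (1 - δ) * (q * L) := by
    have := hI.1
    rw [← div_lt_iff₀ (by positivity)]; linarith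
  have hEm := equivocation_minus_eq_of_posterior hp hW
  have hE := equivocation_eq_of_posterior hp hW
  have hsum := W.sum_sum_prob
  have hs := W.sum_prob_input_nonneg
  obtain ⟨s, hsd⟩ : ∃ s : W.Out → ℝ, s = fun y => ∑ x, W.prob x y := ⟨_, rfl⟩
  have hsy : ∀ y, ∑ x, W.prob x y = s y := fun y => by rw [hsd]
  simp only [hsy] at hEm hE hsum hs
  have Q2 : q * δ / 2 ≤ ∑ y, if d ≤ entropy (p y) then s y else 0 := by
    have := le_mul_sum_of_le_sum_mul (h := fun y => entropy (p y)) (L := L) (δ := d)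
      (c := q * δ / 2 * L) hs hd0.le (fun y => hLdef ▸ entropy_le_log (hp y)) (by
        rw [hsum, ← hE, hd]
        linarith)
    rw [mul_comm _ L] at this
    exact le_of_mul_le_mul_left this hL
  have Q1 : q * δ / 2 ≤ ∑ y, if d ≤ L - entropy (p y) then s y else 0 := by
    have := le_mul_sum_of_le_sum_mul (h := fun y => L - entropy (p y)) (L := L) (δ := d)
      (c := q * δ / 2 * L) hs hd0.le (fun y => sub_le_self _ (entropy_nonneg (hp y))) (by
        simp only [mul_sub, Finset.sum_sub_distrib, ← Finset.sum_mul]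
        rw [hsum, ← hE, hd]
        linarith)
    rw [mul_comm _ L] at this
    exact le_of_mul_le_mul_left this hL
  have hdiff : W.minus.equivocation - W.equivocation =
      1 / q * ∑ y₁, ∑ y₂, s y₁ * s y₂ * (entropy (diffConv (p y₁) (p y₂)) - entropy (p y₁)) := by
    rw [hEm]
    simp only [mul_sub, Finset.sum_sub_distrib]
    congr 1
    have : ∀ y₁, ∑ y₂, s y₁ * s y₂ * entropy (p y₁) = q * (s y₁ * entropy (p y₁)) := by
      intro y₁
      rw [← Finset.sum_mul, ← Finset.mul_sum, hsum]
      ring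
    simp only [this, ← Finset.mul_sum]
    rw [← hE]
    field_simp
  have hlow : 1 / q * (ε * ((q * δ / 2) * (q * δ / 2))) ≤
      W.minus.equivocation - W.equivocation := by
    rw [hdiff]
    refine mul_le_mul_of_nonneg_left ?_ (by positivity)
    calc ε * ((q * δ / 2) * (q * δ / 2))
        ≤ ε * ((∑ y, if d ≤ L - entropy (p y) then s y else 0) *
            ∑ y, if d ≤ entropy (p y) then s y else 0) := by
          gcongr
          exact le_trans (by positivity) Q1
      _ = ∑ y₁, ∑ y₂, ε * ((if d ≤ L - entropy (p y₁) then s y₁ else 0) *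
            if d ≤ entropy (p y₂) then s y₂ else 0) := by
          rw [Finset.sum_mul_sum, Finset.mul_sum]
          simp only [Finset.mul_sum]
      _ ≤ _ := by
          refine Finset.sum_le_sum fun y₁ _ => Finset.sum_le_sum fun y₂ _ => ?_
          have h0 : 0 ≤ s y₁ * s y₂ *
              (entropy (diffConv (p y₁) (p y₂)) - entropy (p y₁)) :=
            mul_nonneg (mul_nonneg (hs _) (hs _))
              (sub_nonneg.2 (entropy_le_entropy_diffConv (hp _) (hp _)))
          split_ifs with h1 h2
          · have := hgap _ (hp y₁) _ (hp y₂) (by rw [← hLdef]; linarith) h2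
            rw [mul_comm ε]
            exact mul_le_mul_of_nonneg_left this (mul_nonneg (hs _) (hs _))
          all_goals simpa using h0
  have : 1 / q * (ε * ((q * δ / 2) * (q * δ / 2))) / (q * L) ≤
      (W.minus.equivocation - W.equivocation) / (q * L) := by gcongr
  rw [sub_div] at this
  linarith

end PrimeCapacity

end QChannel

namespace QChannel

/-! ### Bhattacharyya sums -/

section Bhattacharyya

variable {q : ℕ}

/-- The Bhattacharyya coefficient of the output laws of two inputs. -/
noncomputable def bhatt (W : QChannel.{u} q) (x x' : ZMod q) : ℝ :=
  ∑ y, Real.sqrt (W.prob x y * W.prob x' y)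

lemma bhatt_nonneg (W : QChannel.{u} q) (x x' : ZMod q) : 0 ≤ W.bhatt x x' :=
  Finset.sum_nonneg fun _ _ => Real.sqrt_nonneg _

lemma bhatt_le_one (W : QChannel.{u} q) (x x' : ZMod q) : W.bhatt x x' ≤ 1 := by
  calc W.bhatt x x' = ∑ y, Real.sqrt (W.prob x y) * Real.sqrt (W.prob x' y) := by
        simp only [bhatt, Real.sqrt_mul (W.prob_nonneg _ _)]
    _ ≤ Real.sqrt (∑ y, W.prob x y) * Real.sqrt (∑ y, W.prob x' y) :=
        Real.sum_sqrt_mul_sqrt_le _ (fun _ => W.prob_nonneg _ _) (fun _ => W.prob_nonneg _ _)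
    _ = 1 := by rw [W.sum_prob, W.sum_prob, Real.sqrt_one, one_mul]

variable [NeZero q]

/-- The sum of the Bhattacharyya coefficients over ordered pairs of distinct inputs. -/
noncomputable def bhattSum (W : QChannel.{u} q) : ℝ :=
  ∑ x, ∑ x' ∈ Finset.univ.filter (fun x' : ZMod q => x ≠ x'), W.bhatt x x'

lemma avgBhattacharyya_eq (W : QChannel.{u} q) :
    W.avgBhattacharyya = 1 / ((q : ℝ) * ((q : ℝ) - 1)) * W.bhattSum := by
  simp only [avgBhattacharyya, bhattSum, bhatt, Finset.mul_sum]

lemma bhattSum_nonneg (W : QChannel.{u} q) : 0 ≤ W.bhattSum :=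
  Finset.sum_nonneg fun _ _ => Finset.sum_nonneg fun _ _ => W.bhatt_nonneg _ _

lemma bhatt_le_bhattSum (W : QChannel.{u} q) {x x' : ZMod q} (h : x ≠ x') :
    W.bhatt x x' ≤ W.bhattSum :=
  (Finset.single_le_sum (f := fun x' => W.bhatt x x') (fun _ _ => W.bhatt_nonneg _ _)
    (Finset.mem_filter.2 ⟨Finset.mem_univ x', h⟩)).trans
  (Finset.single_le_sum
    (f := fun x => ∑ x' ∈ Finset.univ.filter (fun x' : ZMod q => x ≠ x'), W.bhatt x x')
    (fun _ _ => Finset.sum_nonneg fun _ _ => W.bhatt_nonneg _ _) (Finset.mem_univ x))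

lemma bhatt_plus (W : QChannel.{u} q) (u u' : ZMod q) :
    W.plus.bhatt u u' = 1 / q * (∑ c, W.bhatt (c + u) (c + u')) * W.bhatt u u' := by
  have key : ∀ (y₁ y₂ : W.Out) (c : ZMod q),
      Real.sqrt (1 / (q : ℝ) * (W.prob (c + u) y₁ * W.prob u y₂) *
        (1 / (q : ℝ) * (W.prob (c + u') y₁ * W.prob u' y₂))) =
      1 / (q : ℝ) * Real.sqrt (W.prob (c + u) y₁ * W.prob (c + u') y₁) *
        Real.sqrt (W.prob u y₂ * W.prob u' y₂) := by
    intro y₁ y₂ c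
    rw [show 1 / (q : ℝ) * (W.prob (c + u) y₁ * W.prob u y₂) *
        (1 / (q : ℝ) * (W.prob (c + u') y₁ * W.prob u' y₂)) =
        (1 / (q : ℝ)) ^ 2 * ((W.prob (c + u) y₁ * W.prob (c + u') y₁) *
        (W.prob u y₂ * W.prob u' y₂)) by ring, Real.sqrt_mul (by positivity),
      Real.sqrt_sq (by positivity),
      Real.sqrt_mul (mul_nonneg (W.prob_nonneg _ _) (W.prob_nonneg _ _)), mul_assoc]
  calc W.plus.bhatt u u' = ∑ y₁, ∑ y₂, ∑ c : ZMod q,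
        1 / (q : ℝ) * Real.sqrt (W.prob (c + u) y₁ * W.prob (c + u') y₁) *
          Real.sqrt (W.prob u y₂ * W.prob u' y₂) :=
        (Fintype.sum_prod_type _).trans (Finset.sum_congr rfl fun y₁ _ =>
          (Fintype.sum_prod_type _).trans (Finset.sum_congr rfl fun y₂ _ =>
            Finset.sum_congr rfl fun c _ => key y₁ y₂ c))
    _ = _ := by
        simp only [bhatt, ← Finset.mul_sum, ← Finset.sum_mul]
        rw [Finset.sum_comm]

/-- By `bhatt_plus`, the coefficient of a pair of distinct inputs of `W⁺` is a product of two
factors, one of which is an average of coefficients of pairs of distinct inputs of `W`. -/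
lemma bhattSum_plus_le (W : QChannel.{u} q) : W.plus.bhattSum ≤ W.bhattSum ^ 2 := by
  have hq : (q : ℝ) ≠ 0 := NeZero.ne _
  rw [sq]
  nth_rewrite 3 [bhattSum]
  rw [bhattSum, Finset.mul_sum]
  refine Finset.sum_le_sum fun u _ => ?_
  rw [Finset.mul_sum]
  refine Finset.sum_le_sum fun u' hu => ?_
  have hne : u ≠ u' := (Finset.mem_filter.1 hu).2
  rw [bhatt_plus]
  refine mul_le_mul_of_nonneg_right ?_ (W.bhatt_nonneg _ _)
  calc 1 / (q : ℝ) * ∑ c, W.bhatt (c + u) (c + u') ≤ 1 / (q : ℝ) * ∑ _c : ZMod q, W.bhattSum := by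
        gcongr
        exact W.bhatt_le_bhattSum (by simpa using hne)
    _ = W.bhattSum := by
        simp [ZMod.card, hq]

lemma sqrt_sum_le_sum_sqrt {ι : Type*} (s : Finset ι) {f : ι → ℝ} (hf : ∀ i, 0 ≤ f i) :
    Real.sqrt (∑ i ∈ s, f i) ≤ ∑ i ∈ s, Real.sqrt (f i) := by
  refine Real.sqrt_le_iff.2 ⟨Finset.sum_nonneg fun _ _ => Real.sqrt_nonneg _, ?_⟩
  calc ∑ i ∈ s, f i = ∑ i ∈ s, Real.sqrt (f i) ^ 2 :=
        Finset.sum_congr rfl fun i _ => (Real.sq_sqrt (hf i)).symm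
    _ ≤ _ := by
        rw [sq, Finset.sum_mul]
        refine Finset.sum_le_sum fun i hi => ?_
        rw [sq]
        exact mul_le_mul_of_nonneg_left (Finset.single_le_sum (f := fun i => Real.sqrt (f i))
          (fun _ _ => Real.sqrt_nonneg _) hi) (Real.sqrt_nonneg _)

lemma bhatt_minus_le (W : QChannel.{u} q) (u u' : ZMod q) :
    W.minus.bhatt u u' ≤ 1 / q * ∑ a, ∑ b, W.bhatt (u + a) (u' + b) * W.bhatt a b := by
  have key : ∀ (y₁ y₂ : W.Out),
      Real.sqrt ((∑ a, 1 / (q : ℝ) * (W.prob (u + a) y₁ * W.prob a y₂)) *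
        (∑ b, 1 / (q : ℝ) * (W.prob (u' + b) y₁ * W.prob b y₂))) ≤
      ∑ a, ∑ b, 1 / (q : ℝ) * (Real.sqrt (W.prob (u + a) y₁ * W.prob (u' + b) y₁) *
        Real.sqrt (W.prob a y₂ * W.prob b y₂)) := by
    intro y₁ y₂
    rw [Finset.sum_mul_sum]
    have h0 : ∀ a b, 0 ≤ 1 / (q : ℝ) * (W.prob (u + a) y₁ * W.prob a y₂) *
        (1 / (q : ℝ) * (W.prob (u' + b) y₁ * W.prob b y₂)) := fun a b =>
      mul_nonneg (mul_nonneg (by positivity) (mul_nonneg (W.prob_nonneg _ _) (W.prob_nonneg _ _)))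
        (mul_nonneg (by positivity) (mul_nonneg (W.prob_nonneg _ _) (W.prob_nonneg _ _)))
    refine (sqrt_sum_le_sum_sqrt _ fun a => Finset.sum_nonneg fun b _ => h0 a b).trans ?_
    refine Finset.sum_le_sum fun a _ => (sqrt_sum_le_sum_sqrt _ (h0 a)).trans ?_
    refine Finset.sum_le_sum fun b _ => le_of_eq ?_
    rw [show 1 / (q : ℝ) * (W.prob (u + a) y₁ * W.prob a y₂) *
        (1 / (q : ℝ) * (W.prob (u' + b) y₁ * W.prob b y₂)) =
        (1 / (q : ℝ)) ^ 2 * ((W.prob (u + a) y₁ * W.prob (u' + b) y₁) *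
        (W.prob a y₂ * W.prob b y₂)) by ring, Real.sqrt_mul (by positivity),
      Real.sqrt_sq (by positivity),
      Real.sqrt_mul (mul_nonneg (W.prob_nonneg _ _) (W.prob_nonneg _ _))]
  have e : 1 / (q : ℝ) * ∑ a, ∑ b, W.bhatt (u + a) (u' + b) * W.bhatt a b =
      ∑ y₁, ∑ y₂, ∑ a, ∑ b,
        1 / (q : ℝ) * (Real.sqrt (W.prob (u + a) y₁ * W.prob (u' + b) y₁) *
          Real.sqrt (W.prob a y₂ * W.prob b y₂)) := by
    have e₀ : ∀ a b, W.bhatt (u + a) (u' + b) * W.bhatt a b =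
        ∑ y₁, ∑ y₂, Real.sqrt (W.prob (u + a) y₁ * W.prob (u' + b) y₁) *
          Real.sqrt (W.prob a y₂ * W.prob b y₂) := fun a b => by
      rw [bhatt, bhatt, Finset.sum_mul_sum]
    simp only [e₀, Finset.mul_sum]
    calc _ = ∑ a, ∑ y₁, ∑ b, ∑ y₂,
        1 / (q : ℝ) * (Real.sqrt (W.prob (u + a) y₁ * W.prob (u' + b) y₁) *
          Real.sqrt (W.prob a y₂ * W.prob b y₂)) :=
          Finset.sum_congr rfl fun a _ => Finset.sum_comm
      _ = ∑ y₁, ∑ a, ∑ y₂, ∑ b,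
        1 / (q : ℝ) * (Real.sqrt (W.prob (u + a) y₁ * W.prob (u' + b) y₁) *
          Real.sqrt (W.prob a y₂ * W.prob b y₂)) := by
          rw [Finset.sum_comm]
          exact Finset.sum_congr rfl fun _ _ => Finset.sum_congr rfl fun _ _ => Finset.sum_comm
      _ = _ := Finset.sum_congr rfl fun _ _ => Finset.sum_comm
  rw [e, bhatt]
  refine (Fintype.sum_prod_type _).trans_le ?_
  exact Finset.sum_le_sum fun y₁ _ => Finset.sum_le_sum fun y₂ _ => key y₁ y₂

/-- In each term of `bhatt_minus_le`, at least one of the two factors belongs to a pair of distinct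
inputs of `W`; the other one is at most `1`. -/
lemma bhattSum_minus_le (W : QChannel.{u} q) : W.minus.bhattSum ≤ (q : ℝ) ^ 3 * W.bhattSum := by
  have hq : (q : ℝ) ≠ 0 := NeZero.ne _
  have h1 : ∀ u u' : ZMod q, u ≠ u' → W.minus.bhatt u u' ≤ q * W.bhattSum := by
    intro u u' hne
    refine (W.bhatt_minus_le u u').trans ?_
    calc _ ≤ 1 / (q : ℝ) * ∑ _a : ZMod q, ∑ _b : ZMod q, W.bhattSum := by
          gcongr with a _ b _
          by_cases hab : a = b
          · subst hab
            exact (mul_le_of_le_one_right (W.bhatt_nonneg _ _) (W.bhatt_le_one _ _)).trans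
              (W.bhatt_le_bhattSum (by simpa using hne))
          · exact (mul_le_of_le_one_left (W.bhatt_nonneg _ _) (W.bhatt_le_one _ _)).trans
              (W.bhatt_le_bhattSum hab)
      _ = _ := by
          simp only [Finset.sum_const, Finset.card_univ, ZMod.card, nsmul_eq_mul]
          field_simp
  calc W.minus.bhattSum ≤ ∑ _x : ZMod q, ∑ _x' : ZMod q, q * W.bhattSum := by
        refine Finset.sum_le_sum fun x _ => (Finset.sum_le_sum fun x' hx =>
          h1 x x' (Finset.mem_filter.1 hx).2).trans ?_
        exact Finset.sum_le_sum_of_subset_of_nonneg (Finset.subset_univ _) fun _ _ _ =>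
          mul_nonneg (Nat.cast_nonneg _) W.bhattSum_nonneg
    _ = _ := by
        simp only [Finset.sum_const, Finset.card_univ, ZMod.card, nsmul_eq_mul]
        ring

lemma bhatt_le_sqrt_equivocation (W : QChannel.{u} q) {x x' : ZMod q} (h : x ≠ x') :
    W.bhatt x x' ≤ Real.sqrt (q * W.equivocation) := by
  obtain ⟨p, hp, hW⟩ := W.exists_posterior
  have hs := W.sum_prob_input_nonneg
  calc W.bhatt x x' ≤ ∑ y, Real.sqrt (∑ x, W.prob x y) *
        Real.sqrt ((∑ x, W.prob x y) * entropy (p y)) := by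
        refine Finset.sum_le_sum fun y _ => ?_
        rw [← Real.sqrt_mul (hs y), hW y x, hW y x']
        refine Real.sqrt_le_sqrt ?_
        have := mul_le_mul_of_nonneg_left (mul_le_entropy (hp y) h)
          (mul_nonneg (hs y) (hs y))
        linarith
    _ ≤ Real.sqrt (∑ y, ∑ x, W.prob x y) *
        Real.sqrt (∑ y, (∑ x, W.prob x y) * entropy (p y)) :=
        Real.sum_sqrt_mul_sqrt_le _ hs fun y => mul_nonneg (hs y) (entropy_nonneg (hp y))
    _ = _ := by
        rw [W.sum_sum_prob, ← equivocation_eq_of_posterior hp hW, Real.sqrt_mul (by positivity)]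

lemma bhattSum_le_sqrt_equivocation (W : QChannel.{u} q) :
    W.bhattSum ≤ (q : ℝ) ^ 2 * Real.sqrt (q * W.equivocation) := by
  calc W.bhattSum ≤ ∑ _x : ZMod q, ∑ _x' : ZMod q, Real.sqrt (q * W.equivocation) := by
        refine Finset.sum_le_sum fun x _ => (Finset.sum_le_sum fun x' hx =>
          W.bhatt_le_sqrt_equivocation (Finset.mem_filter.1 hx).2).trans ?_
        exact Finset.sum_le_sum_of_subset_of_nonneg (Finset.subset_univ _) fun _ _ _ =>
          Real.sqrt_nonneg _
    _ = _ := by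
        simp only [Finset.sum_const, Finset.card_univ, ZMod.card, nsmul_eq_mul]
        ring

end Bhattacharyya

end QChannel

namespace QChannel

/-! ### The recursion of the polar transform -/

section Transform

/-- A function on `{-, +}ⁿ⁺¹` is a pair of functions on `{-, +}ⁿ`, according to the first sign. -/
def joinEquiv (n : ℕ) (β : Type*) :
    ((Fin n → Bool) → β) × ((Fin n → Bool) → β) ≃ ((Fin (n + 1) → Bool) → β) where
  toFun p t := if t 0 then p.2 (Fin.tail t) else p.1 (Fin.tail t)
  invFun u := (fun s => u (Fin.cons false s), fun s => u (Fin.cons true s))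
  left_inv p := by simp
  right_inv u := by
    funext t
    obtain ⟨b, s, rfl⟩ : ∃ b s, t = Fin.cons b s := ⟨t 0, Fin.tail t, (Fin.cons_self_tail t).symm⟩
    cases b <;> simp

variable {n : ℕ} {β : Type*}

@[simp] lemma joinEquiv_cons_false (a b : (Fin n → Bool) → β) (s : Fin n → Bool) :
    joinEquiv n β (a, b) (Fin.cons false s) = a s := by simp [joinEquiv]

@[simp] lemma joinEquiv_cons_true (a b : (Fin n → Bool) → β) (s : Fin n → Bool) :
    joinEquiv n β (a, b) (Fin.cons true s) = b s := by simp [joinEquiv]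

lemma sum_joinEquiv [Fintype β] (H : ((Fin (n + 1) → Bool) → β) → ℝ) :
    ∑ u, H u = ∑ a, ∑ b, H (joinEquiv n β (a, b)) := by
  rw [← (joinEquiv n β).sum_comp, Fintype.sum_prod_type]

lemma prod_cons (H : (Fin (n + 1) → Bool) → ℝ) :
    ∏ t, H t = ∏ t : Fin n → Bool, H (Fin.cons false t) * H (Fin.cons true t) := by
  rw [← (Fin.consEquiv fun _ => Bool).prod_comp, Fintype.prod_prod_type, Fintype.prod_bool,
    ← Finset.prod_mul_distrib]
  exact Finset.prod_congr rfl fun t _ => mul_comm _ _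

lemma sum_fun_prod {ι γ : Type*} [Fintype ι] [DecidableEq ι] [Fintype β] [Fintype γ]
    (H : (ι → β × γ) → ℝ) : ∑ y, H y = ∑ a : ι → β, ∑ b : ι → γ, H (fun t => (a t, b t)) := by
  rw [← (Equiv.arrowProdEquivProdArrow ι (fun _ => β) (fun _ => γ)).symm.sum_comp,
    Fintype.sum_prod_type]
  rfl

lemma toLex_cons_lt_cons {a b : Bool} {r s : Fin n → Bool} :
    toLex (Fin.cons a r : Fin (n + 1) → Bool) < toLex (Fin.cons b s : Fin (n + 1) → Bool) ↔
      a < b ∨ a = b ∧ toLex r < toLex s :=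
  Fin.pi_lex_lt_cons_cons _

lemma sum_eval {ι : Type*} [Fintype ι] [DecidableEq ι] [Subsingleton ι] [Fintype β] (s : ι)
    (H : β → ℝ) : ∑ u : ι → β, H (u s) = ∑ x, H x := by
  let e : (ι → β) ≃ β :=
    { toFun := fun u => u s
      invFun := fun x _ => x
      left_inv := fun u => funext fun r => congrArg u (Subsingleton.elim s r)
      right_inv := fun _ => rfl }
  exact e.sum_comp H

variable {q : ℕ}

lemma blockProb_nonneg (W : QChannel.{u} q) (u : (Fin n → Bool) → ZMod q)
    (y : (Fin n → Bool) → W.Out) : 0 ≤ W.blockProb u y :=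
  Finset.prod_nonneg fun _ _ => W.prob_nonneg _ _

lemma polarTransform_joinEquiv_false (a b : (Fin n → Bool) → ZMod q) (t : Fin n → Bool) :
    polarTransform (n + 1) (joinEquiv n _ (a, b)) (Fin.cons false t) =
      polarTransform n a t + polarTransform n b t := by
  simp [polarTransform]

lemma polarTransform_joinEquiv_true (a b : (Fin n → Bool) → ZMod q) (t : Fin n → Bool) :
    polarTransform (n + 1) (joinEquiv n _ (a, b)) (Fin.cons true t) = polarTransform n b t := by
  simp [polarTransform]

lemma polarTransform_injective (n : ℕ) :
    Function.Injective (polarTransform (q := q) n) := by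
  induction n with
  | zero => exact fun _ _ h => h
  | succ n ih =>
    intro u u' h
    obtain ⟨⟨a, b⟩, rfl⟩ := (joinEquiv n (ZMod q)).surjective u
    obtain ⟨⟨a', b'⟩, rfl⟩ := (joinEquiv n (ZMod q)).surjective u'
    have hb : polarTransform n b = polarTransform n b' := by
      funext t
      simpa only [polarTransform_joinEquiv_true] using congrFun h (Fin.cons true t)
    have ha : polarTransform n a = polarTransform n a' := by
      funext t
      have := congrFun h (Fin.cons false t)
      rw [polarTransform_joinEquiv_false, polarTransform_joinEquiv_false, hb] at this
      exact add_right_cancel this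
    rw [ih ha, ih hb]

lemma blockProb_joinEquiv (W : QChannel.{u} q) (a b : (Fin n → Bool) → ZMod q)
    (y₁ y₂ : (Fin n → Bool) → W.Out) :
    W.blockProb (joinEquiv n _ (a, b)) (joinEquiv n _ (y₁, y₂)) =
      ∏ t, W.prob (polarTransform n a t + polarTransform n b t) (y₁ t) *
        W.prob (polarTransform n b t) (y₂ t) := by
  rw [blockProb, prod_cons]
  simp only [polarTransform_joinEquiv_false, polarTransform_joinEquiv_true, joinEquiv_cons_false,
    joinEquiv_cons_true]

variable [NeZero q]

lemma sum_comp_polarTransform (H : ((Fin n → Bool) → ZMod q) → ℝ) :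
    ∑ u, H (polarTransform n u) = ∑ v, H v :=
  (Equiv.ofBijective _ (Finite.injective_iff_bijective.1 (polarTransform_injective n))).sum_comp H

variable (W : QChannel.{u} q)

/-- Outputs of copies of `W⁻`, from the outputs of the two families of uses of `W`. -/
def minusOut {ι : Type*} (y₁ y₂ : ι → W.Out) : ι → W.minus.Out := fun t => (y₁ t, y₂ t)

/-- Outputs of copies of `W⁺`, from the outputs of the two families of uses of `W` and the inputs
of the copies of `W⁻`. -/
def plusOut {ι : Type*} (y₁ y₂ : ι → W.Out) (v : ι → ZMod q) : ι → W.plus.Out :=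
  fun t => (y₁ t, y₂ t, v t)

lemma sum_minusOut {ι : Type*} [Fintype ι] [DecidableEq ι] (H : (ι → W.minus.Out) → ℝ) :
    ∑ y, H y = ∑ y₁, ∑ y₂, H (W.minusOut y₁ y₂) :=
  sum_fun_prod (β := W.Out) (γ := W.Out) H

lemma sum_plusOut {ι : Type*} [Fintype ι] [DecidableEq ι] (H : (ι → W.plus.Out) → ℝ) :
    ∑ y, H y = ∑ y₁, ∑ y₂, ∑ v, H (W.plusOut y₁ y₂ v) :=
  (sum_fun_prod (β := W.Out) (γ := W.Out × ZMod q) H).trans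
    (Finset.sum_congr rfl fun y₁ _ => sum_fun_prod (β := W.Out) (γ := ZMod q)
      (fun z => H (fun t => (y₁ t, z t))))

/-- Averaging over the inputs of the `W⁺` copies leaves independent uses of `W⁻`. -/
lemma sum_blockProb_joinEquiv (a : (Fin n → Bool) → ZMod q) (y₁ y₂ : (Fin n → Bool) → W.Out) :
    ∑ b, W.blockProb (joinEquiv n _ (a, b)) (joinEquiv n _ (y₁, y₂)) =
      (q : ℝ) ^ 2 ^ n * W.minus.blockProb a (W.minusOut y₁ y₂) := by
  have hq : (q : ℝ) ≠ 0 := NeZero.ne _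
  simp only [blockProb_joinEquiv]
  rw [sum_comp_polarTransform (fun v => ∏ t, W.prob (polarTransform n a t + v t) (y₁ t) *
    W.prob (v t) (y₂ t))]
  have h1 := (Finset.prod_univ_sum (fun _ : Fin n → Bool => (Finset.univ : Finset (ZMod q)))
    (fun t x => W.prob (polarTransform n a t + x) (y₁ t) * W.prob x (y₂ t))).symm
  rw [Fintype.piFinset_univ] at h1
  have h2 : (q : ℝ) ^ 2 ^ n = ∏ _t : Fin n → Bool, (q : ℝ) := by
    simp
  rw [h1, h2, blockProb, ← Finset.prod_mul_distrib]
  refine Finset.prod_congr rfl fun t _ => ?_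
  simp only [minus, minusOut, ← Finset.mul_sum]
  field_simp

/-- Given the inputs of the `W⁻` copies, there remain independent uses of `W⁺`. -/
lemma blockProb_joinEquiv_eq_plus (a b : (Fin n → Bool) → ZMod q)
    (y₁ y₂ : (Fin n → Bool) → W.Out) :
    W.blockProb (joinEquiv n _ (a, b)) (joinEquiv n _ (y₁, y₂)) =
      (q : ℝ) ^ 2 ^ n *
        W.plus.blockProb b (W.plusOut y₁ y₂ (polarTransform n a)) := by
  have hq : (q : ℝ) ≠ 0 := NeZero.ne _
  have h2 : (q : ℝ) ^ 2 ^ n = ∏ _t : Fin n → Bool, (q : ℝ) := by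
    simp
  rw [blockProb_joinEquiv, h2, blockProb, ← Finset.prod_mul_distrib]
  refine Finset.prod_congr rfl fun t _ => ?_
  simp only [plus, plusOut]
  field_simp

lemma level_cons_false (s : Fin n → Bool) :
    W.level (Fin.cons false s : Fin (n + 1) → Bool) = W.minus.level s := by
  rw [level, List.ofFn_cons]
  rfl

lemma level_cons_true (s : Fin n → Bool) :
    W.level (Fin.cons true s : Fin (n + 1) → Bool) = W.plus.level s := by
  rw [level, List.ofFn_cons]
  rfl

lemma normalization_succ (n : ℕ) :
    1 / (q : ℝ) ^ (2 ^ (n + 1) - 1) * (q : ℝ) ^ 2 ^ n = 1 / (q : ℝ) ^ (2 ^ n - 1) := by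
  have hq : (q : ℝ) ≠ 0 := NeZero.ne _
  have : 2 ^ (n + 1) - 1 = (2 ^ n - 1) + 2 ^ n := by
    have := Nat.one_le_two_pow (n := n)
    rw [pow_succ]
    omega
  rw [this, pow_add]
  field_simp

lemma splitProb_cons_false (y₁ y₂ : (Fin n → Bool) → W.Out) (s : Fin n → Bool)
    (a b : (Fin n → Bool) → ZMod q) (x : ZMod q) :
    W.splitProb (joinEquiv n _ (y₁, y₂)) (Fin.cons false s) (joinEquiv n _ (a, b)) x =
      W.minus.splitProb (W.minusOut y₁ y₂) s a x := by
  classical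
  have key : ∀ a' b' : (Fin n → Bool) → ZMod q,
      ((∀ r : Fin (n + 1) → Bool, toLex r < toLex (Fin.cons false s : Fin (n + 1) → Bool) →
        joinEquiv n _ (a', b') r = joinEquiv n _ (a, b) r) ∧
        joinEquiv n _ (a', b') (Fin.cons false s) = x) ↔
      ((∀ r, toLex r < toLex s → a' r = a r) ∧ a' s = x) := by
    intro a' b'
    simp [Fin.forall_fin_succ_pi, toLex_cons_lt_cons]
  rw [splitProb, splitProb, Finset.sum_filter, Finset.sum_filter, sum_joinEquiv]
  simp only [key]
  rw [← normalization_succ n, mul_assoc, Finset.mul_sum _ _ ((q : ℝ) ^ 2 ^ n)]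
  refine congrArg _ (Finset.sum_congr rfl fun a' _ => ?_)
  split_ifs with h
  · exact sum_blockProb_joinEquiv W a' y₁ y₂
  · simp

lemma splitProb_cons_true (y₁ y₂ : (Fin n → Bool) → W.Out) (s : Fin n → Bool)
    (a b : (Fin n → Bool) → ZMod q) (x : ZMod q) :
    W.splitProb (joinEquiv n _ (y₁, y₂)) (Fin.cons true s) (joinEquiv n _ (a, b)) x =
      W.plus.splitProb (W.plusOut y₁ y₂ (polarTransform n a)) s b x := by
  classical
  have key : ∀ a' b' : (Fin n → Bool) → ZMod q,
      ((∀ r : Fin (n + 1) → Bool, toLex r < toLex (Fin.cons true s : Fin (n + 1) → Bool) →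
        joinEquiv n _ (a', b') r = joinEquiv n _ (a, b) r) ∧
        joinEquiv n _ (a', b') (Fin.cons true s) = x) ↔
      (a' = a ∧ (∀ r, toLex r < toLex s → b' r = b r) ∧ b' s = x) := by
    intro a' b'
    simp [Fin.forall_fin_succ_pi, toLex_cons_lt_cons, funext_iff, and_assoc]
  rw [splitProb, splitProb, Finset.sum_filter, Finset.sum_filter, sum_joinEquiv]
  simp only [key]
  rw [← normalization_succ n, mul_assoc, Finset.mul_sum _ _ ((q : ℝ) ^ 2 ^ n),
    Finset.sum_eq_single a]
  · refine congrArg _ (Finset.sum_congr rfl fun b' _ => ?_)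
    simp only [true_and]
    split_ifs with h
    · exact blockProb_joinEquiv_eq_plus W a b' y₁ y₂
    · simp
  · intro a' _ ha
    simp [ha]
  · simp

/-- The genie-aided successive cancellation decoder, which knows the true earlier symbols, sees
exactly the channel `W^𝐬`: for a uniform input of the polar transform, expectations of functions of
the likelihoods of the symbol `𝐬` and of its true value are the same as for a uniform input of
`W^𝐬`. -/
theorem genie_expectation (s : Fin n → Bool) (G : (ZMod q → ℝ) → ZMod q → ℝ) :
    1 / (q : ℝ) ^ 2 ^ n * ∑ u : (Fin n → Bool) → ZMod q, ∑ y,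
        G (W.splitProb y s u) (u s) * W.blockProb u y =
      1 / q * (W.level s).outputSum (fun f => ∑ x, G f x * f x) := by
  classical
  have hq : (q : ℝ) ≠ 0 := NeZero.ne _
  induction n generalizing W with
  | zero =>
    have hs : ∀ y v, W.splitProb y s v = fun x => W.prob x (y s) := by
      intro y v
      funext x
      have : ∀ u : (Fin 0 → Bool) → ZMod q, ((∀ r, toLex r < toLex s → u r = v r) ∧ u s = x) ↔
          u = fun _ => x := by
        intro u
        constructor
        · rintro ⟨-, rfl⟩
          funext r
          rw [Subsingleton.elim r s]
        · rintro rfl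
          refine ⟨fun r hr => ?_, rfl⟩
          rw [Subsingleton.elim r s] at hr
          exact absurd hr (lt_irrefl _)
      rw [splitProb, Finset.sum_filter]
      simp only [this]
      rw [Finset.sum_ite_eq' Finset.univ]
      rw [if_pos (Finset.mem_univ _), pow_zero, Nat.sub_self, pow_zero, one_div_one, one_mul]
      exact Fintype.prod_subsingleton _ s
    have hb : ∀ (u : (Fin 0 → Bool) → ZMod q) y, W.blockProb u y = W.prob (u s) (y s) := by
      intro u y
      exact Fintype.prod_subsingleton _ s
    have hl : W.level s = W := by
      rw [level, List.ofFn_zero, List.foldl_nil]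
    simp only [hs, hb]
    rw [sum_eval s (fun x => ∑ y : (Fin 0 → Bool) → W.Out,
      G (fun x => W.prob x (y s)) x * W.prob x (y s)), Finset.sum_comm,
      sum_eval s (fun o => ∑ x, G (fun x => W.prob x o) x * W.prob x o), hl, pow_zero, pow_one,
      outputSum]
  | succ n ih =>
    have hN : ∀ X : ℝ, 1 / (q : ℝ) ^ 2 ^ (n + 1) * ((q : ℝ) ^ 2 ^ n * X) =
        1 / (q : ℝ) ^ 2 ^ n * X := by
      intro X
      rw [pow_succ 2 n, mul_two, pow_add]
      field_simp
    obtain ⟨c, s, rfl⟩ : ∃ c s', s = Fin.cons c s' :=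
      ⟨s 0, Fin.tail s, (Fin.cons_self_tail s).symm⟩
    rw [sum_joinEquiv]
    simp only [sum_joinEquiv (β := W.Out)]
    cases c
    · rw [level_cons_false, ← ih W.minus s, ← hN]
      congr 1
      rw [Finset.mul_sum]
      refine Finset.sum_congr rfl fun a _ => ?_
      have e : ∀ b y₁ y₂, W.splitProb (joinEquiv n _ (y₁, y₂)) (Fin.cons false s)
          (joinEquiv n _ (a, b)) = W.minus.splitProb (W.minusOut y₁ y₂) s a :=
        fun b y₁ y₂ => funext fun x => W.splitProb_cons_false y₁ y₂ s a b x
      simp only [e, joinEquiv_cons_false]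
      rw [sum_minusOut]
      rw [Finset.sum_comm, Finset.mul_sum]
      refine Finset.sum_congr rfl fun y₁ _ => ?_
      rw [Finset.sum_comm, Finset.mul_sum]
      refine Finset.sum_congr rfl fun y₂ _ => ?_
      rw [← Finset.mul_sum, sum_blockProb_joinEquiv]
      ring
    · rw [level_cons_true, ← ih W.plus s, ← hN]
      congr 1
      have e : ∀ a b y₁ y₂, W.splitProb (joinEquiv n _ (y₁, y₂)) (Fin.cons true s)
          (joinEquiv n _ (a, b)) =
          W.plus.splitProb (W.plusOut y₁ y₂ (polarTransform n a)) s b :=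
        fun a b y₁ y₂ => funext fun x => W.splitProb_cons_true y₁ y₂ s a b x
      simp only [e, joinEquiv_cons_true, blockProb_joinEquiv_eq_plus]
      rw [Finset.sum_comm, Finset.mul_sum]
      refine Finset.sum_congr rfl fun b _ => ?_
      rw [sum_plusOut, Finset.sum_comm, Finset.mul_sum]
      refine Finset.sum_congr rfl fun y₁ _ => ?_
      rw [Finset.sum_comm, Finset.mul_sum]
      refine Finset.sum_congr rfl fun y₂ _ => ?_
      rw [← sum_comp_polarTransform fun v => G (W.plus.splitProb (W.plusOut y₁ y₂ v) s b) (b s) *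
        W.plus.blockProb b (W.plusOut y₁ y₂ v), Finset.mul_sum]
      exact Finset.sum_congr rfl fun a _ => by ring

end Transform

end QChannel

namespace QChannel

/-! ### Successive cancellation decoding -/

section Decoding

variable {q : ℕ} [NeZero q] (W : QChannel.{u} q) {n : ℕ}

lemma splitProb_congr (y : (Fin n → Bool) → W.Out) (s : Fin n → Bool)
    {v v' : (Fin n → Bool) → ZMod q} (h : ∀ r, toLex r < toLex s → v r = v' r) :
    W.splitProb y s v = W.splitProb y s v' := by
  funext x
  rw [splitProb, splitProb]
  congr 2
  ext u
  simp only [Finset.mem_filter, Finset.mem_univ, true_and]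
  refine and_congr_left fun _ => forall₂_congr fun r hr => ?_
  rw [h r hr]

/-- A decoding error has a first wrong symbol, and there the decoder knows the true values of the
earlier symbols. -/
lemma exists_genie_error {σ : (ZMod q → ℝ) → ZMod q} {A : Finset (Fin n → Bool)}
    {m : {s // s ∈ A} → ZMod q} {f : {s // s ∉ A} → ZMod q} {y : (Fin n → Bool) → W.Out}
    (h : W.scDecode σ A f y ≠ codeInput A m f) :
    ∃ s ∈ A, σ (W.splitProb y s (codeInput A m f)) ≠ codeInput A m f s := by
  by_contra hcon
  push Not at hcon
  suffices ∀ s : Lex (Fin n → Bool), W.scDecode σ A f y (ofLex s) = codeInput A m f (ofLex s) from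
    h (funext fun s => this (toLex s))
  intro s
  induction s using (wellFounded_lt (α := Lex (Fin n → Bool))).induction with
  | _ s ih =>
  rw [scDecode]
  split_ifs with hs
  · rw [← hcon (ofLex s) hs]
    congr 1
    refine W.splitProb_congr y (ofLex s) fun r hr => ?_
    rw [if_pos hr]
    exact ih (toLex r) hr
  · rw [codeInput, dif_neg hs]

lemma sum_codeInput (A : Finset (Fin n → Bool)) (H : ((Fin n → Bool) → ZMod q) → ℝ) :
    ∑ f : {s // s ∉ A} → ZMod q, ∑ m : {s // s ∈ A} → ZMod q, H (codeInput A m f) = ∑ u, H u := by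
  rw [← (Equiv.piEquivPiSubtypeProd (fun s => s ∈ A) (fun _ => ZMod q)).symm.sum_comp,
    Fintype.sum_prod_type, Finset.sum_comm]
  rfl

/-- The maximum likelihood error bound: a wrong decision needs a larger likelihood of some wrong
letter, and `min a b ≤ √(a b)`. -/
lemma outputSum_error_le {σ : (ZMod q → ℝ) → ZMod q} (hσ : IsArgmaxRule σ) :
    W.outputSum (fun f => ∑ x, (if σ f ≠ x then 1 else 0) * f x) ≤ W.bhattSum := by
  have key : W.bhattSum = ∑ y, ∑ x, ∑ x' ∈ Finset.univ.filter (fun x' : ZMod q => x ≠ x'),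
      Real.sqrt (W.prob x y * W.prob x' y) := by
    rw [bhattSum, Finset.sum_comm]
    refine Finset.sum_congr rfl fun x _ => ?_
    simp only [bhatt]
    exact Finset.sum_comm
  rw [key, outputSum]
  refine Finset.sum_le_sum fun y _ => Finset.sum_le_sum fun x _ => ?_
  split_ifs with h
  · rw [one_mul]
    calc W.prob x y = Real.sqrt (W.prob x y * W.prob x y) :=
          (Real.sqrt_mul_self (W.prob_nonneg x y)).symm
      _ ≤ Real.sqrt (W.prob x y * W.prob (σ fun x => W.prob x y) y) :=
          Real.sqrt_le_sqrt (mul_le_mul_of_nonneg_left (hσ (fun x => W.prob x y) x)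
            (W.prob_nonneg x y))
      _ ≤ _ := Finset.single_le_sum (f := fun x' => Real.sqrt (W.prob x y * W.prob x' y))
          (fun _ _ => Real.sqrt_nonneg _)
          (Finset.mem_filter.2 ⟨Finset.mem_univ (σ fun x => W.prob x y), Ne.symm h⟩)
  · rw [zero_mul]
    exact Finset.sum_nonneg fun _ _ => Real.sqrt_nonneg _

/-- The union bound over the first wrong symbol. -/
theorem avgBlockError_le {σ : (ZMod q → ℝ) → ZMod q} (hσ : IsArgmaxRule σ)
    (A : Finset (Fin n → Bool)) :
    W.avgBlockError σ A ≤ ∑ s ∈ A, 1 / q * (W.level s).bhattSum := by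
  classical
  have hq : (q : ℝ) ≠ 0 := NeZero.ne _
  have hA : A.card ≤ 2 ^ n := by
    have := A.card_le_univ
    rwa [Fintype.card_fun, Fintype.card_bool, Fintype.card_fin] at this
  have hbound : ∀ (f : {s // s ∉ A} → ZMod q) (m : {s // s ∈ A} → ZMod q),
      ∑ y ∈ Finset.univ.filter (fun y : (Fin n → Bool) → W.Out =>
        W.scDecode σ A f y ≠ codeInput A m f), W.blockProb (codeInput A m f) y ≤
      ∑ y, ∑ s ∈ A, (if σ (W.splitProb y s (codeInput A m f)) ≠ codeInput A m f s
        then 1 else 0) * W.blockProb (codeInput A m f) y := by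
    intro f m
    rw [Finset.sum_filter]
    refine Finset.sum_le_sum fun y _ => ?_
    have hB := W.blockProb_nonneg (codeInput A m f) y
    have hterm : ∀ s ∈ A, 0 ≤ (if σ (W.splitProb y s (codeInput A m f)) ≠ codeInput A m f s
        then (1 : ℝ) else 0) * W.blockProb (codeInput A m f) y := fun s _ =>
      mul_nonneg (by split_ifs <;> norm_num) hB
    split_ifs with h
    · obtain ⟨s, hs, hne⟩ := W.exists_genie_error h
      refine le_trans (le_of_eq ?_) (Finset.single_le_sum hterm hs)
      rw [if_pos hne, one_mul]
    · exact Finset.sum_nonneg hterm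
  calc W.avgBlockError σ A
      = 1 / (q : ℝ) ^ 2 ^ n * ∑ f : {s // s ∉ A} → ZMod q, ∑ m : {s // s ∈ A} → ZMod q,
          ∑ y ∈ Finset.univ.filter (fun y : (Fin n → Bool) → W.Out =>
            W.scDecode σ A f y ≠ codeInput A m f), W.blockProb (codeInput A m f) y := by
        simp only [avgBlockError, blockError, ← Finset.mul_sum]
        rw [← mul_assoc, ← Nat.sub_add_cancel hA, pow_add, Nat.sub_add_cancel hA]
        congr 1
        · field_simp
    _ ≤ 1 / (q : ℝ) ^ 2 ^ n * ∑ f : {s // s ∉ A} → ZMod q, ∑ m : {s // s ∈ A} → ZMod q,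
          ∑ y, ∑ s ∈ A, (if σ (W.splitProb y s (codeInput A m f)) ≠ codeInput A m f s
            then 1 else 0) * W.blockProb (codeInput A m f) y := by
        gcongr with f _ m _
        exact hbound f m
    _ = ∑ s ∈ A, 1 / (q : ℝ) ^ 2 ^ n * ∑ u : (Fin n → Bool) → ZMod q, ∑ y,
          (if σ (W.splitProb y s u) ≠ u s then 1 else 0) * W.blockProb u y := by
        rw [sum_codeInput A (fun u => ∑ y, ∑ s ∈ A,
          (if σ (W.splitProb y s u) ≠ u s then 1 else 0) * W.blockProb u y), ← Finset.mul_sum]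
        exact congrArg _ ((Finset.sum_congr rfl fun u _ => Finset.sum_comm).trans Finset.sum_comm)
    _ ≤ _ := by
        refine Finset.sum_le_sum fun s _ => ?_
        rw [W.genie_expectation s (fun f x => if σ f ≠ x then 1 else 0)]
        exact mul_le_mul_of_nonneg_left ((W.level s).outputSum_error_le hσ) (by positivity)

/-- Some choice of the frozen symbols is at least as good as the average. -/
lemma exists_blockError_le (σ : (ZMod q → ℝ) → ZMod q) (A : Finset (Fin n → Bool)) :
    ∃ f : {s // s ∉ A} → ZMod q, W.blockError σ A f ≤ W.avgBlockError σ A := by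
  classical
  have hq : (q : ℝ) ≠ 0 := NeZero.ne _
  obtain ⟨f, -, hf⟩ := Finset.exists_le_of_sum_le
    (s := (Finset.univ : Finset ({s // s ∉ A} → ZMod q)))
    (f := fun f => W.blockError σ A f) (g := fun _ => W.avgBlockError σ A)
    Finset.univ_nonempty (by
      have hcard : Fintype.card {s // s ∉ A} = 2 ^ n - A.card := by
        rw [Fintype.card_subtype_compl, Fintype.card_coe, Fintype.card_fun, Fintype.card_bool,
          Fintype.card_fin]
      rw [Finset.sum_const, Finset.card_univ, Fintype.card_fun, ZMod.card, hcard, nsmul_eq_mul,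
        avgBlockError]
      push_cast
      rw [← mul_assoc, mul_one_div_cancel (pow_ne_zero _ hq), one_mul])
  exact ⟨f, hf⟩

end Decoding

end QChannel

namespace QChannel

open BranchingProcess Filter

/-! ### Polarization -/

section Polarization

lemma step_false {q : ℕ} [NeZero q] (W : QChannel.{u} q) : step W false = W.minus := rfl

lemma step_true {q : ℕ} [NeZero q] (W : QChannel.{u} q) : step W true = W.plus := rfl

lemma unpolarizedFraction_eq {q : ℕ} [NeZero q] (W : QChannel.{u} q) (δ : ℝ) (n : ℕ) :
    W.unpolarizedFraction δ n =
      avgProb step n {V : QChannel.{u} q | V.symCapacity ∈ Set.Ioo δ (1 - δ)} W := by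
  simp only [unpolarizedFraction, avgProb_eq_card, Set.mem_ofPred_eq, level]

variable {q : ℕ} [Fact q.Prime]

lemma avg_symCapacity (W : QChannel.{u} q) (n : ℕ) :
    avg step n (symCapacity (q := q)) W = W.symCapacity := by
  rw [avg_of_stepAvg_eq]
  funext V
  rw [stepAvg, step_false, step_true, V.symCapacity_minus_add_plus]
  ring

/-- The capacity is a bounded martingale along the branching, so its increments vanish in mean
square; by the uniform capacity gap they do not vanish on unpolarized channels. -/
theorem tendsto_unpolarizedFraction (W : QChannel.{u} q) {δ : ℝ} (hδ : 0 < δ) :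
    Tendsto (fun n : ℕ => W.unpolarizedFraction δ n) atTop (nhds 0) := by
  obtain ⟨ε, hε, hgap⟩ := exists_capacity_gap (q := q) hδ
  obtain ⟨M, hM⟩ : ∃ M : ℕ → ℝ,
      M = fun n => avg step n (fun V : QChannel.{u} q => V.symCapacity ^ 2) W := ⟨_, rfl⟩
  have hstep : ∀ V : QChannel.{u} q, V.symCapacity ^ 2 +
      ε ^ 2 * {V : QChannel.{u} q | V.symCapacity ∈ Set.Ioo δ (1 - δ)}.indicator 1 V ≤
      stepAvg step (fun V => V.symCapacity ^ 2) V := by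
    intro V
    have h := V.symCapacity_minus_add_plus
    have hp : V.plus.symCapacity = 2 * V.symCapacity - V.minus.symCapacity := by linarith
    simp only [stepAvg, step_false, step_true, hp]
    by_cases hV : V ∈ {V : QChannel.{u} q | V.symCapacity ∈ Set.Ioo δ (1 - δ)}
    · rw [Set.indicator_of_mem hV]
      have := hgap V hV
      simp only [Pi.one_apply, mul_one]
      nlinarith
    · rw [Set.indicator_of_notMem hV]
      nlinarith [sq_nonneg (V.symCapacity - V.minus.symCapacity)]
  have hinc : ∀ n, M n + ε ^ 2 * W.unpolarizedFraction δ n ≤ M (n + 1) := by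
    intro n
    rw [hM, unpolarizedFraction_eq, avgProb, ← avg_const_mul, ← avg_add]
    simp only [avg_succ_stepAvg]
    exact avg_mono hstep n W
  have hnn : ∀ n, 0 ≤ W.unpolarizedFraction δ n := fun n => by
    rw [unpolarizedFraction_eq]
    exact avgProb_nonneg _ _ _
  have hmono : Monotone M := monotone_nat_of_le_succ fun n => by
    have := mul_nonneg (sq_nonneg ε) (hnn n)
    linarith [hinc n]
  have hbdd : BddAbove (Set.range M) := by
    refine ⟨1, ?_⟩
    rintro _ ⟨n, rfl⟩
    rw [hM]
    have := avg_mono (st := step) (φ := fun V : QChannel.{u} q => V.symCapacity ^ 2)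
      (ψ := fun _ => 1) (fun V => pow_le_one₀ V.symCapacity_nonneg V.symCapacity_le_one) n W
    rwa [avg_const] at this
  have hlim := tendsto_atTop_ciSup hmono hbdd
  have hdiff : Tendsto (fun n => (M (n + 1) - M n) / ε ^ 2) atTop (nhds 0) := by
    have := ((hlim.comp (tendsto_add_atTop_nat 1)).sub hlim).div_const (ε ^ 2)
    simpa using this
  refine squeeze_zero hnn (fun n => ?_) hdiff
  rw [le_div_iff₀ (by positivity)]
  linarith [hinc n]

/-- A nearly perfect channel has a small Bhattacharyya sum. -/
lemma exists_bhattSum_le {ζ : ℝ} (hζ : 0 < ζ) : ∃ δ : ℝ, 0 < δ ∧ ∀ V : QChannel.{u} q,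
    1 - δ ≤ V.symCapacity → V.bhattSum ≤ ζ := by
  have hq : (0 : ℝ) < q := alphabet_pos
  have hL : 0 < Real.log q := log_alphabet_pos
  refine ⟨(ζ / q ^ 2) ^ 2 / (q * (q * Real.log q)), by positivity, fun V hV => ?_⟩
  rw [symCapacity_eq, sub_le_sub_iff_left, div_le_div_iff₀ (by positivity) (by positivity)] at hV
  have h1 : q * V.equivocation ≤ (ζ / q ^ 2) ^ 2 := by
    have : (q * V.equivocation) * (q * Real.log q) ≤ (ζ / q ^ 2) ^ 2 * (q * Real.log q) := by
      linarith
    exact le_of_mul_le_mul_right this (by positivity)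
  refine V.bhattSum_le_sqrt_equivocation.trans ?_
  calc (q : ℝ) ^ 2 * Real.sqrt (q * V.equivocation)
      ≤ (q : ℝ) ^ 2 * Real.sqrt ((ζ / q ^ 2) ^ 2) := by gcongr
    _ = ζ := by
        rw [Real.sqrt_sq (by positivity)]
        field_simp

/-- By polarization and conservation of the mean capacity, a fraction `I(W)` of the channels is
nearly perfect. -/
lemma eventually_avgProb_bhattSum_gt (W : QChannel.{u} q) {ζ : ℝ} (hζ : 0 < ζ) {ε : ℝ}
    (hε : 0 < ε) : ∀ᶠ m in atTop,
      avgProb step m {V : QChannel.{u} q | ζ < V.bhattSum} W ≤ 1 - W.symCapacity + ε := by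
  obtain ⟨δ₀, hδ₀, hδ₀'⟩ := exists_bhattSum_le (q := q) hζ
  obtain ⟨δ, hδ⟩ : ∃ δ, δ = min δ₀ (ε / 2) := ⟨_, rfl⟩
  have hδ0 : 0 < δ := hδ ▸ lt_min hδ₀ (by positivity)
  have hδ1 : δ ≤ δ₀ := hδ ▸ min_le_left _ _
  have hδ2 : δ ≤ ε / 2 := hδ ▸ min_le_right _ _
  filter_upwards [(W.tendsto_unpolarizedFraction hδ0).eventually_le_const
    (by positivity : 0 < ε / 2)] with m hm
  rw [unpolarizedFraction_eq] at hm
  have key : ∀ V : QChannel.{u} q,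
      {V : QChannel.{u} q | ζ < V.bhattSum}.indicator (1 : QChannel.{u} q → ℝ) V ≤
      {V : QChannel.{u} q | V.symCapacity ∈ Set.Ioo δ (1 - δ)}.indicator 1 V +
        (-1 * V.symCapacity + (1 + δ)) := by
    intro V
    have h1 := V.symCapacity_le_one
    have h2 := indicator_one_nonneg
      {V : QChannel.{u} q | V.symCapacity ∈ Set.Ioo δ (1 - δ)} V
    by_cases hV : V ∈ {V : QChannel.{u} q | ζ < V.bhattSum}
    · rw [Set.indicator_of_mem hV, Pi.one_apply]
      have h3 : V.symCapacity < 1 - δ := by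
        by_contra hcon
        exact absurd (hδ₀' V (by linarith)) (not_le.2 hV)
      by_cases h4 : δ < V.symCapacity
      · rw [Set.indicator_of_mem (show V ∈ {V : QChannel.{u} q |
          V.symCapacity ∈ Set.Ioo δ (1 - δ)} from ⟨h4, h3⟩), Pi.one_apply]
        linarith
      · linarith
    · rw [Set.indicator_of_notMem hV]
      linarith
  have := avg_mono (st := step) key m W
  rw [avg_add, avg_add, avg_const_mul, avg_const, avg_symCapacity] at this
  rw [avgProb] at hm ⊢
  linarith

/-- The fraction of channels whose Bhattacharyya sum is not doubly exponentially small. -/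
lemma eventually_avgProb_bhattSum_rate (W : QChannel.{u} q) {β : ℝ} (hβ0 : 0 < β)
    (hβ : β < 1 / 2) {ε : ℝ} (hε : 0 < ε) : ∀ᶠ n : ℕ in atTop,
      avgProb step n {V : QChannel.{u} q | Real.exp (-(2 : ℝ) ^ (β * n)) < V.bhattSum} W ≤
        1 - W.symCapacity + ε := by
  have hq : (1 : ℝ) ≤ q := by exact_mod_cast (Fact.out : q.Prime).one_lt.le
  exact eventually_avgProb_rate (st := step) (S := bhattSum) (fun V => V.bhattSum_nonneg)
    (one_le_pow₀ hq : (1 : ℝ) ≤ (q : ℝ) ^ 3) (fun V => V.bhattSum_minus_le)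
    (fun V => V.bhattSum_plus_le)
    (fun ζ hζ ε hε => W.eventually_avgProb_bhattSum_gt hζ hε) hβ0 hβ hε

end Polarization

/-! ### Rate of polar codes -/

section Rate

variable {q : ℕ} [Fact q.Prime]

/-- If there are more good channels than information symbols, all information symbols see good
channels. -/
lemma bhattSum_le_of_mem_infoSet {W : QChannel.{u} q} {n : ℕ} {A : Finset (Fin n → Bool)}
    (hA : W.IsPolarInfoSet A) {t : ℝ}
    (hcard : (A.card : ℝ) / 2 ^ n ≤ 1 - avgProb step n {V : QChannel.{u} q | t < V.bhattSum} W)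
    {s : Fin n → Bool} (hs : s ∈ A) : (W.level s).bhattSum ≤ t := by
  classical
  by_contra hcon
  have hq1 : (1 : ℝ) < q := by exact_mod_cast (Fact.out : q.Prime).one_lt
  have hpos : 0 < 1 / ((q : ℝ) * ((q : ℝ) - 1)) := by
    have : 0 < (q : ℝ) - 1 := by linarith
    positivity
  rw [avgProb_eq_card, Nat.card_eq_fintype_card, Fintype.card_subtype] at hcard
  obtain ⟨B, hB⟩ : ∃ B : Finset (Fin n → Bool), B = Finset.univ.filter
    fun s => (List.ofFn s).foldl step W ∈ {V : QChannel.{u} q | t < V.bhattSum} := ⟨_, rfl⟩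
  rw [← hB] at hcard
  have hmemB : ∀ r, r ∈ B ↔ t < (W.level r).bhattSum := by
    intro r
    rw [hB, Finset.mem_filter]
    exact and_iff_right (Finset.mem_univ r)
  -- a good channel outside `A` would be better than `s`, which is bad
  have hsub : insert s Bᶜ ⊆ A := by
    intro r hr
    rcases Finset.mem_insert.1 hr with rfl | hr
    · exact hs
    · by_contra hrA
      have h1 := hA s hs r hrA
      rw [avgBhattacharyya_eq, avgBhattacharyya_eq] at h1
      have h2 := le_of_mul_le_mul_left h1 hpos
      rw [Finset.mem_compl, hmemB] at hr
      linarith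
  have h3 := Finset.card_le_card hsub
  rw [Finset.card_insert_of_notMem (by
    rw [Finset.mem_compl, not_not, hmemB]
    exact not_le.1 hcon)] at h3
  have h4 := Finset.card_compl_add_card B
  rw [Fintype.card_fun, Fintype.card_bool, Fintype.card_fin] at h4
  have h5 : (A.card : ℝ) + B.card ≤ 2 ^ n := by
    rw [le_sub_iff_add_le, ← add_div, div_le_one (by positivity)] at hcard
    exact hcard
  have h6 : A.card + B.card ≤ 2 ^ n := by exact_mod_cast h5
  omega

/-- The factor `2ⁿ` of the union bound is absorbed by a slightly larger exponent. -/
lemma eventually_two_pow_mul_exp_le {β γ : ℝ} (hβ0 : 0 ≤ β) (hβγ : β < γ) :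
    ∀ᶠ n : ℕ in atTop,
      (2 : ℝ) ^ n * Real.exp (-(2 : ℝ) ^ (γ * n)) ≤ (2 : ℝ) ^ (-((2 : ℝ) ^ n) ^ β) := by
  have h1 : ∀ᶠ n : ℕ in atTop, (n : ℝ) + 1 ≤ (2 : ℝ) ^ ((γ - β) * n) := by
    have hr : 1 < (2 : ℝ) ^ (γ - β) := Real.one_lt_rpow one_lt_two (by linarith)
    have ht := tendsto_pow_const_div_const_pow_of_one_lt 1 hr
    have ht0 := (tendsto_pow_atTop_atTop_of_one_lt hr).eventually_ge_atTop 2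
    filter_upwards [ht.eventually_le_const (by norm_num : (0 : ℝ) < 1 / 2), ht0] with n hn hn0
    rw [Real.rpow_mul zero_le_two, Real.rpow_natCast]
    rw [pow_one, div_le_iff₀ (by positivity)] at hn
    linarith
  filter_upwards [h1] with n hn
  have e1 : ((2 : ℝ) ^ n) ^ β = (2 : ℝ) ^ (β * n) := by
    rw [← Real.rpow_natCast, ← Real.rpow_mul zero_le_two, mul_comm]
  have hX : 1 ≤ (2 : ℝ) ^ (β * n) := Real.one_le_rpow one_le_two (by positivity)
  have hn0 : (0 : ℝ) ≤ n := by positivity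
  have hsplit : (2 : ℝ) ^ (γ * n) = (2 : ℝ) ^ ((γ - β) * n) * (2 : ℝ) ^ (β * n) := by
    rw [← Real.rpow_add two_pos]; congr 1; ring
  have h2 : n + (2 : ℝ) ^ (β * n) ≤ (2 : ℝ) ^ (γ * n) := by
    rw [hsplit]
    nlinarith
  have hlog : Real.log 2 ≤ 1 := by linarith [Real.log_two_lt_d9]
  have hlog0 : 0 ≤ Real.log 2 := Real.log_nonneg one_le_two
  rw [e1, ← Real.rpow_natCast, Real.rpow_def_of_pos two_pos n, Real.rpow_def_of_pos two_pos (-_),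
    ← Real.exp_add, Real.exp_le_exp]
  nlinarith

end Rate

end QChannel

theorem theorem1 (q : ℕ) [Fact q.Prime] (W : QChannel.{u} q) :
    (∀ δ : ℝ, 0 < δ →
      Filter.Tendsto (fun n : ℕ => W.unpolarizedFraction δ n) Filter.atTop (nhds 0)) ∧
    (∀ R : ℝ, R < W.symCapacity → ∀ β : ℝ, β < 1 / 2 →
      ∃ n₀ : ℕ, ∀ n : ℕ, n₀ ≤ n →
        ∀ A : Finset (Fin n → Bool), A.card = ⌊(2 : ℝ) ^ n * R⌋₊ → W.IsPolarInfoSet A →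
        ∀ σ : (ZMod q → ℝ) → ZMod q, QChannel.IsArgmaxRule σ →
          W.avgBlockError σ A ≤ (2 : ℝ) ^ (-((2 : ℝ) ^ n) ^ β) ∧
          ∃ f : {s // s ∉ A} → ZMod q,
            W.blockError σ A f ≤ (2 : ℝ) ^ (-((2 : ℝ) ^ n) ^ β)) := by
  refine ⟨fun δ hδ => W.tendsto_unpolarizedFraction hδ, fun R hR β hβ => ?_⟩
  have hq1 : (1 : ℝ) ≤ q := by exact_mod_cast (Fact.out : q.Prime).one_lt.le
  obtain ⟨b, hb⟩ : ∃ b, b = max β 0 := ⟨_, rfl⟩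
  have hb0 : 0 ≤ b := hb ▸ le_max_right _ _
  have hβb : β ≤ b := hb ▸ le_max_left _ _
  have hb2 : b < 1 / 2 := hb ▸ max_lt hβ (by norm_num)
  obtain ⟨γ, hγ⟩ : ∃ γ, γ = (b + 1 / 2) / 2 := ⟨_, rfl⟩
  obtain ⟨n₀, hn₀⟩ := Filter.eventually_atTop.1
    ((W.eventually_avgProb_bhattSum_rate (β := γ) (by linarith) (by linarith)
      (sub_pos.2 hR)).and
    (QChannel.eventually_two_pow_mul_exp_le (γ := γ) hb0 (by linarith)))
  refine ⟨n₀, fun n hn A hcard hA σ hσ => ?_⟩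
  obtain ⟨hfrac, hexp⟩ := hn₀ n hn
  have havg : W.avgBlockError σ A ≤ (2 : ℝ) ^ (-((2 : ℝ) ^ n) ^ β) := by
    have hgood : ∀ s ∈ A, 1 / (q : ℝ) * (W.level s).bhattSum ≤
        Real.exp (-(2 : ℝ) ^ (γ * n)) := by
      intro s hs
      -- for negative `R` the floor is `0` and `A` is empty
      have hR0 : 0 ≤ (2 : ℝ) ^ n * R := by
        by_contra hneg
        rw [Nat.floor_of_nonpos (not_le.1 hneg).le, Finset.card_eq_zero] at hcard
        simp [hcard] at hs
      have hfloor : (A.card : ℝ) ≤ 2 ^ n * R := by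
        rw [hcard]
        exact Nat.floor_le hR0
      have h1 : (W.level s).bhattSum ≤ Real.exp (-(2 : ℝ) ^ (γ * n)) := by
        refine QChannel.bhattSum_le_of_mem_infoSet hA ?_ hs
        rw [div_le_iff₀ (by positivity)]
        have : (2 : ℝ) ^ n * R ≤ 2 ^ n * (1 - BranchingProcess.avgProb QChannel.step n
            {V : QChannel.{u} q | Real.exp (-(2 : ℝ) ^ (γ * n)) < V.bhattSum} W) := by
          gcongr
          linarith
        linarith
      refine le_trans ?_ h1
      exact mul_le_of_le_one_left (W.level s).bhattSum_nonneg
        (by rw [one_div]; exact inv_le_one_of_one_le₀ hq1)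
    have hA2 : (A.card : ℝ) ≤ 2 ^ n := by
      have := A.card_le_univ
      rw [Fintype.card_fun, Fintype.card_bool, Fintype.card_fin] at this
      exact_mod_cast this
    calc W.avgBlockError σ A ≤ ∑ s ∈ A, 1 / (q : ℝ) * (W.level s).bhattSum :=
          W.avgBlockError_le hσ A
      _ ≤ ∑ _s ∈ A, Real.exp (-(2 : ℝ) ^ (γ * n)) := Finset.sum_le_sum hgood
      _ = A.card * Real.exp (-(2 : ℝ) ^ (γ * n)) := by rw [Finset.sum_const, nsmul_eq_mul]
      _ ≤ 2 ^ n * Real.exp (-(2 : ℝ) ^ (γ * n)) := by gcongr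
      _ ≤ (2 : ℝ) ^ (-((2 : ℝ) ^ n) ^ b) := hexp
      _ ≤ (2 : ℝ) ^ (-((2 : ℝ) ^ n) ^ β) := by
          refine Real.rpow_le_rpow_of_exponent_le one_le_two (neg_le_neg ?_)
          exact Real.rpow_le_rpow_of_exponent_le (one_le_pow₀ one_le_two) hβb
  obtain ⟨f, hf⟩ := W.exists_blockError_le σ A
  exact ⟨havg, f, hf.trans havg⟩
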